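/- Let $k$ be a field; all rings are associative unital $k$-algebras, homomorphisms are $k$-algebra homomorphisms, and modules are right modules. **Points and topology.** For a homomorphism $\varphi:A\to B$ the contraction $M^c$ of a $B$-module $M$ is $M$ regarded as an $A$-module through $\varphi$. An $A$-module is *aprime* if it is isomorphic to the contraction of a simple $B$-module along some homomorphism $A\to B$. Let $\operatorname{aSpec}A$ be the set of isomorphism classes of aprime $A$-modules, with the topology generated by the sets $D(f)=\{P : p\mapsto pf \text{ is injective on } P\}$, $f\in A$. **Local functions.** Let $M=\bigoplus_{i=1}^r M_i$ be a finite sum of $A$-modules. A *lift* of $M$ consists of a $k$-algebra $S$ with homomorphisms $k^r\to S\xrightarrow{\pi} k^r$ composing to the identity, which is complete, $S\cong\varprojlim_n S/(\ker\pi)^n$, and a homomorphism $\varphi: A\to\operatorname{End}_S(S\otimes_{k^r}M)$ (endomorphisms composed from left to right) reducing under $\pi$ to the structure maps $\eta_{M_i}:A\to\operatorname{End}_k(M_i)$. The ring $O^A_M$ of functions locally defined at $M$ is the subring of the product of the rings $\operatorname{End}_S(S\otimes_{k^r}M)$ over all lifts generated by the images of $A$ and $k^r$ together with the inverses of those $a\in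 A$ that become units in this product; $\rho: A\to O^A_M$ is the canonical map. If $A$ has a pre-completion in $M$, i.e. a lift $(\hat H,\hat\rho)$ from which every lift $(S,\varphi)$ is obtained by base change along a morphism $\hat H\to S$ of augmented algebras (unique when $S$ is the $r\times r$ tangent algebra), then $O^A_M$ is the subring of $\operatorname{End}_{\hat H}(\hat H\otimes_{k^r}M)$ generated by $\hat\rho(A)$, $k^r$ and the inverses $\hat\rho(a)^{-1}$ of units $\hat\rho(a)$. **Structure sheaf.** For families $P=(P_1,\dots,P_n)$ of points and maps $f:\{1,\dots,m\}\to\{1,\dots,n\}$ there are canonical homomorphisms $O^A_{\oplus_i P_i}\to O^A_{\oplus_j P_{f(j)}}$ compatible with the maps from $A$ and with $k^n\to k^m$, $c\mapsto c\circ f$ (for injective $f$: projection to a partial sum). Let $O_X(U)$ be the limit of the rings $O^A_{\oplus_i P_i}$ over all finite families of points of an open set $U\subseteq X=\operatorname{aSpec}A$, and let $\mathcal O_X$ be the sheaf of rings associated to the presheaf $O_X$. Thus $\operatorname{aSpec}A$ is a ringed space. **Corollary.** Let $\varphi:A\to B$ be a homomorphism of associative rings. 1. For every finite family $P_1,\dots,P_n$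 of points of $\operatorname{aSpec}B$ there is a unique ring homomorphism $\varphi^*_P:O^A_{\oplus P_i^c}\to O^B_{\oplus P_i}$ compatible with $\varphi$ (that is, $\varphi^*_P\circ\rho=\rho\circ\varphi$) and with the maps from $k^n$. 2. There is a unique morphism of ringed spaces $\operatorname{aSpec}(\varphi):\operatorname{aSpec}B\to\operatorname{aSpec}A$ which on points sends $P$ to its contraction $P^c$, and which on structure sheaves is induced by a morphism of presheaves given at every finite family $P$ by $\varphi^*_P$. 3. These morphisms are natural: $\operatorname{aSpec}(\mathrm{id}_A)=\mathrm{id}$ and $\operatorname{aSpec}(\psi\circ\varphi)=\operatorname{aSpec}(\varphi)\circ\operatorname{aSpec}(\psi)$ for $\psi:B\to C$. -/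

import Mathlib

open CategoryTheory MulOpposite
open scoped TensorProduct

universe u

namespace AssocScheme

/-! ### Complete augmented algebras -/

/-- A `k`-algebra `H` augmented over `k^ι`: algebra homomorphisms `k^ι → H → k^ι` whose composite is
the identity.  The image of `k^ι` need not be central. -/
structure AugAlg (k : Type u) [Field k] (ι : Type) [Fintype ι] : Type (u + 1) where
  carrier : Type u
  [ring : Ring carrier]
  [algebra : Algebra k carrier]
  incl : (ι → k) →ₐ[k] carrier
  aug : carrier →ₐ[k] (ι → k)
  aug_incl : ∀ c, aug (incl c) = c

attribute [instance] AugAlg.ring AugAlg.algebra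

section Aug

variable {k : Type u} [Field k] {ι : Type} [Fintype ι]

/-- The augmentation ideal. -/
def AugAlg.ideal (S : AugAlg k ι) : Ideal S.carrier := RingHom.ker S.aug

/-- `S` is complete: the canonical map `S → lim S / 𝔪ⁿ` is injective (first condition) and surjective
(second condition), `𝔪` the augmentation ideal. -/
def AugAlg.IsComplete (S : AugAlg k ι) : Prop :=
  (∀ x : S.carrier, (∀ n : ℕ, x ∈ S.ideal ^ n) → x = 0) ∧
  (∀ s : ℕ → S.carrier, (∀ n, s (n + 1) - s n ∈ S.ideal ^ n) →
    ∃ x, ∀ n, x - s n ∈ S.ideal ^ n)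

/-- `S` is isomorphic to the tangent algebra `T = T(V) / (ker π)²`, `V = (k)_{i,j}`: its augmentation
ideal has square zero and each of the blocks `eᵢ 𝔪 eⱼ` is one-dimensional. -/
def AugAlg.IsTangent [DecidableEq ι] (S : AugAlg k ι) : Prop :=
  S.ideal ^ 2 = ⊥ ∧
  ∀ i j : ι, ∃ t ∈ S.ideal, t ≠ 0 ∧
    S.incl (Pi.single i 1) * t * S.incl (Pi.single j 1) = t ∧
    ∀ x ∈ S.ideal, ∃ c : k, S.incl (Pi.single i 1) * x * S.incl (Pi.single j 1) = c • t

/-- `S` is a right module over the commutative ring `k^ι`. -/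
instance AugAlg.rightModule (S : AugAlg k ι) : Module (ι → k) S.carrier where
  smul c s := s * S.incl c
  one_smul s := by change s * S.incl 1 = s; rw [map_one, mul_one]
  mul_smul c d s := by
    change s * S.incl (c * d) = (s * S.incl d) * S.incl c
    rw [mul_comm, map_mul, mul_assoc]
  smul_zero c := by change 0 * S.incl c = 0; rw [zero_mul]
  smul_add c s t := by change (s + t) * S.incl c = s * S.incl c + t * S.incl c; rw [add_mul]
  add_smul c d s := by
    change s * S.incl (c + d) = s * S.incl c + s * S.incl d; rw [map_add, mul_add]
  zero_smul s := by change s * S.incl 0 = 0; rw [map_zero, mul_zero]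

theorem AugAlg.right_smul_def (S : AugAlg k ι) (c : ι → k) (s : S.carrier) :
    c • s = s * S.incl c := rfl

instance AugAlg.smulCommClass (S : AugAlg k ι) : SMulCommClass (ι → k) S.carrier S.carrier where
  smul_comm c s t := by
    simp only [S.right_smul_def, smul_eq_mul, mul_assoc]

/-- For a family `M` of `k`-vector spaces, the left `S`-module `S ⊗_{k^ι} M`, where `M = ⊕ᵢ Mᵢ`. -/
abbrev AugAlg.Tens (S : AugAlg k ι) (M : ι → Type u) [∀ i, AddCommGroup (M i)]
    [∀ i, Module k (M i)] : Type u :=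
  TensorProduct (ι → k) S.carrier (∀ i, M i)

/-- The reduction `π ⊗ 1 : S ⊗_{k^ι} M → k^ι ⊗_{k^ι} M = M`, `s ⊗ m ↦ π(s) m`. -/
def AugAlg.red (S : AugAlg k ι) (M : ι → Type u) [∀ i, AddCommGroup (M i)]
    [∀ i, Module k (M i)] : S.Tens M →+ (∀ i, M i) :=
  TensorProduct.liftAddHom
    (AddMonoidHom.mk' (fun s => AddMonoidHom.mk' (fun m => S.aug s • m) (fun m n => smul_add _ m n))
      (fun s t => by ext m : 1; exact (by simp only [map_add]; exact add_smul _ _ m)))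
    (fun c s m => by
      change S.aug (s * S.incl c) • m = S.aug s • c • m
      rw [map_mul, S.aug_incl, mul_smul])

@[simp] theorem AugAlg.red_tmul (S : AugAlg k ι) (M : ι → Type u) [∀ i, AddCommGroup (M i)]
    [∀ i, Module k (M i)] (s : S.carrier) (m : ∀ i, M i) :
    S.red M (s ⊗ₜ[ι → k] m) = S.aug s • m := rfl

theorem AugAlg.red_smul (S : AugAlg k ι) (M : ι → Type u) [∀ i, AddCommGroup (M i)]
    [∀ i, Module k (M i)] (s : S.carrier) (x : S.Tens M) :
    S.red M (s • x) = S.aug s • S.red M x := by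
  induction x using TensorProduct.induction_on with
  | zero => simp
  | tmul t m => simp [TensorProduct.smul_tmul', mul_smul]
  | add x y hx hy => simp only [smul_add, map_add, hx, hy]

/-- The endomorphism `1 ⊗ c` of the left `S`-module `S ⊗_{k^ι} M`, for `c ∈ k^ι`. -/
def AugAlg.scal (S : AugAlg k ι) (M : ι → Type u) [∀ i, AddCommGroup (M i)]
    [∀ i, Module k (M i)] (c : ι → k) : Module.End S.carrier (S.Tens M) where
  toFun x := c • x
  map_add' x y := smul_add c x y
  map_smul' s x := by
    induction x using TensorProduct.induction_on with
    | zero => simp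
    | tmul t m => simp only [TensorProduct.smul_tmul', smul_comm c s t, RingHom.id_apply]
    | add x y hx hy => simp only [smul_add, hx, hy]

/-- The ring `End_S(S ⊗_{k^ι} M)`, with the multiplication that composes from left to right
(endomorphisms are written on the right, since `M` is made of right modules). -/
def AugAlg.EndRing (S : AugAlg k ι) (M : ι → Type u) [∀ i, AddCommGroup (M i)]
    [∀ i, Module k (M i)] : Type u := (Module.End S.carrier (S.Tens M))ᵐᵒᵖ

instance (S : AugAlg k ι) (M : ι → Type u) [∀ i, AddCommGroup (M i)] [∀ i, Module k (M i)] :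
    Ring (S.EndRing M) := inferInstanceAs (Ring (Module.End S.carrier (S.Tens M))ᵐᵒᵖ)

/-- An element of `End_S(S ⊗_{k^ι} M)` as an `S`-linear map. -/
def AugAlg.EndRing.act {S : AugAlg k ι} {M : ι → Type u} [∀ i, AddCommGroup (M i)]
    [∀ i, Module k (M i)] (x : S.EndRing M) : Module.End S.carrier (S.Tens M) := unop x

/-- An `S`-linear map as an element of `End_S(S ⊗_{k^ι} M)`. -/
def AugAlg.EndRing.of {S : AugAlg k ι} {M : ι → Type u} [∀ i, AddCommGroup (M i)]
    [∀ i, Module k (M i)] (x : Module.End S.carrier (S.Tens M)) : S.EndRing M := op x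

section

variable {S : AugAlg k ι} {M : ι → Type u} [∀ i, AddCommGroup (M i)] [∀ i, Module k (M i)]

theorem AugAlg.EndRing.ext_act {x y : S.EndRing M} (h : ∀ z, x.act z = y.act z) : x = y :=
  unop_injective (LinearMap.ext h)

theorem AugAlg.EndRing.act_mul (x y : S.EndRing M) (z : S.Tens M) :
    (x * y).act z = y.act (x.act z) := rfl

theorem AugAlg.EndRing.act_add (x y : S.EndRing M) (z : S.Tens M) :
    (x + y).act z = x.act z + y.act z := rfl

theorem AugAlg.EndRing.act_one (z : S.Tens M) : (1 : S.EndRing M).act z = z := rfl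

theorem AugAlg.EndRing.act_zero (z : S.Tens M) : (0 : S.EndRing M).act z = 0 := rfl

end

end Aug

/-! ### Lifts, pre-completions and the ring of local functions -/

section Loc

variable (k A : Type u) [Field k] [Ring A] [Algebra k A] {ι : Type} [Fintype ι]
  (M : ι → Type u) [∀ i, AddCommGroup (M i)] [∀ i, Module k (M i)] [∀ i, Module Aᵐᵒᵖ (M i)]

/-- A lift of the family of right `A`-modules `M`: a complete algebra `S` augmented over `k^ι` and a
`k`-algebra homomorphism `φ : A → End_S(S ⊗_{k^ι} M)` which reduces to the structure morphisms
`η_{Mᵢ}` of the `Mᵢ` under `π_S`. -/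
structure Lift : Type (u + 1) where
  S : AugAlg k ι
  complete : S.IsComplete
  hom : A →+* S.EndRing M
  hom_algebraMap : ∀ (c : k) (x : S.Tens M),
    (hom (algebraMap k A c)).act x = algebraMap k S.carrier c • x
  red_hom : ∀ (a : A) (x : S.Tens M), S.red M ((hom a).act x) = op a • S.red M x

/-- The product of the algebras `End_S(S ⊗_{k^ι} M)` over all lifts of `M`. -/
abbrev LiftProd : Type (u + 1) := ∀ L : Lift k A M, L.S.EndRing M

/-- The homomorphism from `A` whose components are all the lifts of `M`. -/
def liftHom : A →+* LiftProd k A M := RingHom.pi fun L => L.hom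

/-- The action of `k^ι` in all the lifts of `M`. -/
def liftScal (c : ι → k) : LiftProd k A M := fun L => AugAlg.EndRing.of (L.S.scal M c)

variable {A} in
/-- The subring generated by the image of a ring homomorphism `ρ` from `A`, by a further set of
elements, and by the inverses of all `ρ(a)` that are units. -/
def localSubring {R : Type*} [Ring R] (ρ : A →+* R) (E : Set R) : Subring R :=
  Subring.closure (Set.range ρ ∪ E ∪ {x | ∃ a, x * ρ a = 1 ∧ ρ a * x = 1})

/-- The ring `O^A_M` of functions locally defined at `M = ⊕ᵢ Mᵢ`: generated over `k^ι` by the image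
of `A` and by the inverses of the elements of `A` which become units, everything being computed
in all lifts of `M` at once.  If `A` has a pre-completion `Ĥ` in `M`, this is the subring of
`End_Ĥ(Ĥ ⊗ M)` generated in the same way; see `localRing_preCompletion`. -/
def localRing : Subring (LiftProd k A M) :=
  localSubring (liftHom k A M) (Set.range (liftScal k A M))

variable {A} in
/-- The canonical homomorphism `ρ : A → O^A_M`. -/
def toLocalRing : A →+* localRing k A M :=
  (liftHom k A M).codRestrict _ fun a => Subring.subset_closure (Or.inl (Or.inl ⟨a, rfl⟩))

/-- The canonical map `k^ι → O^A_M`. -/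
def scalLocalRing (c : ι → k) : localRing k A M :=
  ⟨liftScal k A M c, Subring.subset_closure (Or.inl (Or.inr ⟨c, rfl⟩))⟩

end Loc

set_option linter.unusedSectionVars false

/-! ### Base change of endomorphism rings -/

section BaseChange

variable {k : Type u} [Field k] {I J : Type} [Fintype I] [Fintype J]
  {M : I → Type u} [∀ i, AddCommGroup (M i)] [∀ i, Module k (M i)]
  {N : J → Type u} [∀ j, AddCommGroup (N j)] [∀ j, Module k (N j)]

/-- The map `⊕ᵢ Mᵢ → ⊕ⱼ Nⱼ` given by linear maps `M_{f j} → Nⱼ`. -/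
def reindex (f : J → I) (θ : ∀ j, M (f j) →ₗ[k] N j) : (∀ i, M i) →+ (∀ j, N j) :=
  AddMonoidHom.mk' (fun m j => θ j (m (f j))) (fun m n => by ext j; simp)

@[simp] theorem reindex_apply (f : J → I) (θ : ∀ j, M (f j) →ₗ[k] N j) (m : ∀ i, M i) (j : J) :
    reindex f θ m j = θ j (m (f j)) := rfl

theorem reindex_smul (f : J → I) (θ : ∀ j, M (f j) →ₗ[k] N j) (c : I → k) (m : ∀ i, M i) :
    reindex f θ (c • m) = (c ∘ f) • reindex f θ m := by
  ext j; simp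

/-- The map `ψ ⊗ θ : R ⊗_{k^I} M → S ⊗_{k^J} N`. -/
def AugAlg.baseMap {R : AugAlg k I} {S : AugAlg k J} (f : J → I) (ψ : R.carrier →ₐ[k] S.carrier)
    (hψ : ∀ c, ψ (R.incl c) = S.incl (c ∘ f)) (θ : ∀ j, M (f j) →ₗ[k] N j) :
    R.Tens M →+ S.Tens N :=
  TensorProduct.liftAddHom
    (AddMonoidHom.mk' (fun r => AddMonoidHom.mk' (fun m => ψ r ⊗ₜ[J → k] reindex f θ m)
      (fun m n => by rw [map_add, TensorProduct.tmul_add]))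
      (fun s t => by
        ext m : 1
        change ψ (s + t) ⊗ₜ[J → k] _ = ψ s ⊗ₜ[J → k] _ + ψ t ⊗ₜ[J → k] _
        rw [map_add, TensorProduct.add_tmul]))
    (fun c r m => by
      change ψ (r * R.incl c) ⊗ₜ[J → k] reindex f θ m = ψ r ⊗ₜ[J → k] reindex f θ (c • m)
      rw [reindex_smul, map_mul, hψ, ← S.right_smul_def, TensorProduct.smul_tmul])

section

variable {R : AugAlg k I} {S : AugAlg k J} (f : J → I) (ψ : R.carrier →ₐ[k] S.carrier)
    (hψ : ∀ c, ψ (R.incl c) = S.incl (c ∘ f)) 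

@[simp] theorem AugAlg.baseMap_tmul (θ : ∀ j, M (f j) →ₗ[k] N j) (r : R.carrier) (m : ∀ i, M i) :
    AugAlg.baseMap f ψ hψ θ (r ⊗ₜ[I → k] m) = ψ r ⊗ₜ[J → k] reindex f θ m := rfl

theorem AugAlg.baseMap_smul (θ : ∀ j, M (f j) →ₗ[k] N j) (r : R.carrier) (x : R.Tens M) :
    AugAlg.baseMap f ψ hψ θ (r • x) = ψ r • AugAlg.baseMap f ψ hψ θ x := by
  induction x using TensorProduct.induction_on with
  | zero => simp
  | tmul t m => simp [TensorProduct.smul_tmul']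
  | add x y hx hy => simp only [smul_add, map_add, hx, hy]

theorem AugAlg.baseMap_scal (θ : ∀ j, M (f j) →ₗ[k] N j) (c : I → k) (x : R.Tens M) :
    AugAlg.baseMap f ψ hψ θ (c • x) = (c ∘ f) • AugAlg.baseMap f ψ hψ θ x := by
  induction x using TensorProduct.induction_on with
  | zero => simp
  | tmul t m => simp [TensorProduct.smul_tmul', R.right_smul_def, S.right_smul_def, hψ]
  | add x y hx hy => simp only [smul_add, map_add, hx, hy]

variable [DecidableEq I] [DecidableEq J] (θ : ∀ j, M (f j) ≃ₗ[k] N j)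

/-- The element `nⱼ` moved to the summand `M_{f j}`. -/
def pick (n : ∀ j, N j) (j : J) : ∀ i, M i := Pi.single (f j) ((θ j).symm (n j))

theorem pick_add (n n' : ∀ j, N j) (j : J) :
    pick f θ (n + n') j = pick f θ n j + pick f θ n' j := by
  simp [pick, Pi.single_add]

theorem pick_smul (c : J → k) (n : ∀ j, N j) (j : J) :
    pick f θ (c • n) j = (fun _ : I => c j) • pick f θ n j := by
  ext i
  by_cases h : i = f j
  · subst h; simp [pick]
  · simp [pick, Pi.single_eq_of_ne h]

theorem pick_reindex (m : ∀ i, M i) (j : J) :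
    pick f θ (reindex f (fun j => (θ j).toLinearMap) m) j
      = (Pi.single (f j) 1 : I → k) • m := by
  ext i
  by_cases h : i = f j
  · subst h; simp [pick]
  · simp [pick, Pi.single_eq_of_ne h]

theorem single_reindex_pick (n : ∀ j, N j) (j : J) :
    (Pi.single j 1 : J → k) • reindex f (fun j => (θ j).toLinearMap) (pick f θ n j)
      = (Pi.single j 1 : J → k) • n := by
  ext i
  by_cases h : i = j
  · subst h; simp [pick]
  · simp [Pi.single_eq_of_ne h]

theorem AugAlg.sum_incl (S : AugAlg k J) : ∑ j, S.incl (Pi.single j 1) = 1 := by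
  have h : ∑ j, (Pi.single j 1 : J → k) = 1 := Finset.univ_sum_single (1 : J → k)
  rw [← map_sum, h, map_one]

/-- Elements of `S ⊗ N` are determined by the image of `R ⊗ M`. -/
theorem AugAlg.tmul_eq_sum (s : S.carrier) (n : ∀ j, N j) :
    s ⊗ₜ[J → k] n = ∑ j, (s * S.incl (Pi.single j 1)) •
      AugAlg.baseMap f ψ hψ (fun j => (θ j).toLinearMap) (1 ⊗ₜ[I → k] pick f θ n j) := by
  have : ∀ j, (s * S.incl (Pi.single j 1)) •
      AugAlg.baseMap f ψ hψ (fun j => (θ j).toLinearMap) (1 ⊗ₜ[I → k] pick f θ n j)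
      = (s * S.incl (Pi.single j 1)) ⊗ₜ[J → k] n := by
    intro j
    rw [AugAlg.baseMap_tmul, map_one, TensorProduct.smul_tmul', smul_eq_mul, mul_one]
    have e : s * S.incl (Pi.single j 1) = (Pi.single j 1 : J → k) •
        (s * S.incl (Pi.single j 1)) := by
      rw [S.right_smul_def, mul_assoc, ← map_mul, ← Pi.single_mul, mul_one]
    rw [e, TensorProduct.smul_tmul, single_reindex_pick, ← TensorProduct.smul_tmul]
  rw [Finset.sum_congr rfl fun j _ => this j, ← TensorProduct.sum_tmul, ← Finset.mul_sum,
    S.sum_incl, mul_one]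

theorem AugAlg.end_ext {y y' : Module.End S.carrier (S.Tens N)}
    (h : ∀ z : R.Tens M, y (AugAlg.baseMap f ψ hψ (fun j => (θ j).toLinearMap) z)
      = y' (AugAlg.baseMap f ψ hψ (fun j => (θ j).toLinearMap) z)) : y = y' := by
  ext x
  induction x using TensorProduct.induction_on with
  | zero => simp
  | tmul s n => rw [AugAlg.tmul_eq_sum f ψ hψ θ s n]; simp only [map_sum, map_smul, h]
  | add x y hx hy => simp only [map_add, hx, hy]

/-- The balanced biadditive map behind the base change of an endomorphism. -/
def AugAlg.extAux (g : (∀ i, M i) →+ S.Tens N) : S.carrier →+ (∀ j, N j) →+ S.Tens N :=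
  AddMonoidHom.mk' (fun s => AddMonoidHom.mk'
      (fun n => ∑ j, (s * S.incl (Pi.single j 1)) • g (pick f θ n j))
      (fun m n => by simp only [pick_add, map_add, smul_add, Finset.sum_add_distrib]))
    (fun s t => DFunLike.ext _ _ fun n => by
      change ∑ j, ((s + t) * S.incl (Pi.single j 1)) • g (pick f θ n j)
        = ∑ j, (s * S.incl (Pi.single j 1)) • g (pick f θ n j)
          + ∑ j, (t * S.incl (Pi.single j 1)) • g (pick f θ n j)
      simp only [add_mul, add_smul, Finset.sum_add_distrib])

theorem AugAlg.extAux_apply (g : (∀ i, M i) →+ S.Tens N) (s : S.carrier) (n : ∀ j, N j) :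
    AugAlg.extAux f θ g s n = ∑ j, (s * S.incl (Pi.single j 1)) • g (pick f θ n j) := rfl

theorem single_mul_comp (c : J → k) (j : J) :
    (c * Pi.single j 1 : J → k) = Pi.single j 1 * ((fun _ : I => c j) ∘ f) := by
  ext i
  by_cases h : i = j
  · subst h; simp
  · simp [Pi.single_eq_of_ne h]

/-- Extension of a `k^I`-semilinear map `M → S ⊗ N` to an `S`-linear endomorphism of `S ⊗ N`. -/
def AugAlg.ext (g : (∀ i, M i) →+ S.Tens N)
    (hg : ∀ c m, g (c • m) = S.incl (c ∘ f) • g m) : Module.End S.carrier (S.Tens N) where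
  toFun := TensorProduct.liftAddHom (AugAlg.extAux f θ g) (fun c s n => by
      rw [AugAlg.extAux_apply, AugAlg.extAux_apply]
      refine Finset.sum_congr rfl fun j _ => ?_
      rw [pick_smul, hg, smul_smul, S.right_smul_def, mul_assoc, mul_assoc,
        ← map_mul, ← map_mul, single_mul_comp f c j])
  map_add' x y := map_add _ x y
  map_smul' s y := by
    induction y using TensorProduct.induction_on with
    | zero => simp
    | tmul t n =>
      rw [TensorProduct.smul_tmul']
      simp only [TensorProduct.liftAddHom_tmul, AugAlg.extAux_apply, RingHom.id_apply,
        Finset.smul_sum, smul_smul, smul_eq_mul, mul_assoc]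
    | add x y hx hy => simp only [smul_add, map_add, hx, hy]

theorem AugAlg.ext_tmul (g : (∀ i, M i) →+ S.Tens N)
    (hg : ∀ c m, g (c • m) = S.incl (c ∘ f) • g m) (s : S.carrier) (n : ∀ j, N j) :
    AugAlg.ext f θ g hg (s ⊗ₜ[J → k] n)
      = ∑ j, (s * S.incl (Pi.single j 1)) • g (pick f θ n j) := rfl

theorem AugAlg.one_tmul_smul (c : I → k) (m : ∀ i, M i) :
    (1 : R.carrier) ⊗ₜ[I → k] (c • m) = R.incl c • ((1 : R.carrier) ⊗ₜ[I → k] m) := by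
  rw [← TensorProduct.smul_tmul, R.right_smul_def, one_mul,
    TensorProduct.smul_tmul', smul_eq_mul, mul_one]

/-- Base change of an endomorphism along `ψ`. -/
def AugAlg.baseEnd (x : Module.End R.carrier (R.Tens M)) : Module.End S.carrier (S.Tens N) :=
  AugAlg.ext f θ (AddMonoidHom.mk'
      (fun m => AugAlg.baseMap f ψ hψ (fun j => (θ j).toLinearMap) (x (1 ⊗ₜ[I → k] m)))
      (fun m n => by rw [TensorProduct.tmul_add, map_add, map_add]))
    (fun c m => by
      change AugAlg.baseMap f ψ hψ (fun j => (θ j).toLinearMap) (x (1 ⊗ₜ[I → k] (c • m)))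
        = S.incl (c ∘ f) •
          AugAlg.baseMap f ψ hψ (fun j => (θ j).toLinearMap) (x (1 ⊗ₜ[I → k] m))
      rw [AugAlg.one_tmul_smul, x.map_smul, AugAlg.baseMap_smul, hψ])

theorem AugAlg.baseEnd_tmul (x : Module.End R.carrier (R.Tens M)) (s : S.carrier)
    (n : ∀ j, N j) : AugAlg.baseEnd f ψ hψ θ x (s ⊗ₜ[J → k] n)
      = ∑ j, (s * S.incl (Pi.single j 1)) •
        AugAlg.baseMap f ψ hψ (fun j => (θ j).toLinearMap) (x (1 ⊗ₜ[I → k] pick f θ n j)) := rfl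

theorem AugAlg.baseEnd_baseMap (x : Module.End R.carrier (R.Tens M)) (z : R.Tens M) :
    AugAlg.baseEnd f ψ hψ θ x (AugAlg.baseMap f ψ hψ (fun j => (θ j).toLinearMap) z)
      = AugAlg.baseMap f ψ hψ (fun j => (θ j).toLinearMap) (x z) := by
  induction z using TensorProduct.induction_on with
  | zero => simp
  | add x y hx hy => simp only [map_add, hx, hy]
  | tmul r m =>
    have h0 : r ⊗ₜ[I → k] m = r • ((1 : R.carrier) ⊗ₜ[I → k] m) := by
      rw [TensorProduct.smul_tmul', smul_eq_mul, mul_one]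
    rw [h0, AugAlg.baseMap_smul, LinearMap.map_smul, x.map_smul, AugAlg.baseMap_smul]
    congr 1
    rw [AugAlg.baseMap_tmul, AugAlg.baseEnd_tmul]
    have h1 : ∀ j, (ψ 1 * S.incl (Pi.single j 1)) •
        AugAlg.baseMap f ψ hψ (fun j => (θ j).toLinearMap)
          (x (1 ⊗ₜ[I → k] pick f θ (reindex f (fun j => (θ j).toLinearMap) m) j))
        = S.incl (Pi.single j 1) •
          AugAlg.baseMap f ψ hψ (fun j => (θ j).toLinearMap) (x (1 ⊗ₜ[I → k] m)) := by
      intro j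
      rw [pick_reindex, AugAlg.one_tmul_smul, x.map_smul, AugAlg.baseMap_smul, hψ, smul_smul,
        map_one, one_mul, ← map_mul]
      congr 2
      ext i
      by_cases h : i = j
      · subst h; simp
      · simp [Pi.single_eq_of_ne h]
    rw [Finset.sum_congr rfl fun j _ => h1 j, ← Finset.sum_smul, S.sum_incl, one_smul]

/-- Base change of endomorphisms as a ring homomorphism. -/
def AugAlg.baseRingHom : R.EndRing M →+* S.EndRing N :=
  RingHom.op
  { toFun := AugAlg.baseEnd f ψ hψ θ
    map_one' := AugAlg.end_ext f ψ hψ θ fun z => by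
      rw [AugAlg.baseEnd_baseMap, Module.End.one_apply, Module.End.one_apply]
    map_mul' := fun x y => AugAlg.end_ext f ψ hψ θ fun z => by
      rw [AugAlg.baseEnd_baseMap, Module.End.mul_apply, Module.End.mul_apply,
        AugAlg.baseEnd_baseMap, AugAlg.baseEnd_baseMap]
    map_zero' := AugAlg.end_ext f ψ hψ θ fun z => by
      rw [AugAlg.baseEnd_baseMap, LinearMap.zero_apply, LinearMap.zero_apply, map_zero]
    map_add' := fun x y => AugAlg.end_ext f ψ hψ θ fun z => by
      rw [AugAlg.baseEnd_baseMap, LinearMap.add_apply, LinearMap.add_apply, map_add,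
        AugAlg.baseEnd_baseMap, AugAlg.baseEnd_baseMap] }

theorem AugAlg.baseRingHom_eq {x : R.EndRing M}
    {y : S.EndRing N}
    (h : ∀ z, y.act (AugAlg.baseMap f ψ hψ (fun j => (θ j).toLinearMap) z)
      = AugAlg.baseMap f ψ hψ (fun j => (θ j).toLinearMap) (x.act z)) :
    AugAlg.baseRingHom f ψ hψ θ x = y := by
  refine unop_injective (AugAlg.end_ext f ψ hψ θ fun z => ?_)
  exact (AugAlg.baseEnd_baseMap f ψ hψ θ x.act z).trans (h z).symm

end

end BaseChange

/-! ### Pre-completions -/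

section PreCompletion

variable {k A : Type u} [Field k] [Ring A] [Algebra k A] {ι : Type} [Fintype ι] [DecidableEq ι]
  {M : ι → Type u} [∀ i, AddCommGroup (M i)] [∀ i, Module k (M i)] [∀ i, Module Aᵐᵒᵖ (M i)]

/-- A morphism `ψ : R → S` of algebras augmented over `k^ι`. -/
structure AugAlg.Hom (R S : AugAlg k ι) where
  toAlgHom : R.carrier →ₐ[k] S.carrier
  map_incl : ∀ c, toAlgHom (R.incl c) = S.incl c
  aug_map : ∀ r, S.aug (toAlgHom r) = R.aug r

/-- The map `ψ ⊗ 1 : R ⊗_{k^ι} M → S ⊗_{k^ι} M`. -/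
def AugAlg.Hom.tens {R S : AugAlg k ι} (ψ : R.Hom S) (M : ι → Type u) [∀ i, AddCommGroup (M i)]
    [∀ i, Module k (M i)] : R.Tens M →+ S.Tens M :=
  AugAlg.baseMap id ψ.toAlgHom ψ.map_incl fun _ => LinearMap.id

/-- The ring homomorphism `Π(ψ) : End_R(R ⊗ M) → End_S(S ⊗ M)` given by base change along `ψ`; it is
characterised by `Π(ψ)(x) ∘ (ψ ⊗ 1) = (ψ ⊗ 1) ∘ x`, see `AugAlg.Hom.endMap_tens`. -/
def AugAlg.Hom.endMap {R S : AugAlg k ι} (ψ : R.Hom S) (M : ι → Type u)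
    [∀ i, AddCommGroup (M i)] [∀ i, Module k (M i)] :
    R.EndRing M →+* S.EndRing M :=
  AugAlg.baseRingHom id ψ.toAlgHom ψ.map_incl fun i => LinearEquiv.refl k (M i)

theorem AugAlg.Hom.endMap_tens {R S : AugAlg k ι} (ψ : R.Hom S)
    (x : R.EndRing M) (z : R.Tens M) :
    (ψ.endMap M x).act (ψ.tens M z) = ψ.tens M (x.act z) :=
  AugAlg.baseEnd_baseMap id ψ.toAlgHom ψ.map_incl (fun i => LinearEquiv.refl k (M i)) x.act z

theorem AugAlg.Hom.endMap_scal {R S : AugAlg k ι} (ψ : R.Hom S) (c : ι → k) :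
    ψ.endMap M (AugAlg.EndRing.of (R.scal M c)) = AugAlg.EndRing.of (S.scal M c) :=
  AugAlg.baseRingHom_eq id ψ.toAlgHom ψ.map_incl (fun i => LinearEquiv.refl k (M i)) fun z =>
    (AugAlg.baseMap_scal id ψ.toAlgHom ψ.map_incl _ c z).symm

/-- `(Ĥ, ρ̂) = (H.S, H.hom)` is a pre-completion of `A` in `M`: every lift `L` of `M` is of the form
`Π(ψ) ∘ ρ̂` for a morphism `ψ` of augmented algebras, unique if `L.S` is isomorphic to the tangent
algebra. -/
def Lift.IsPreCompletion (H : Lift k A M) : Prop :=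
  ∀ L : Lift k A M, (∃ ψ : H.S.Hom L.S, ∀ a, ψ.endMap M (H.hom a) = L.hom a) ∧
    (L.S.IsTangent → ∀ ψ ψ' : H.S.Hom L.S, (∀ a, ψ.endMap M (H.hom a) = L.hom a) →
      (∀ a, ψ'.endMap M (H.hom a) = L.hom a) → ψ = ψ')

theorem localSubring_le_comap {R R' : Type*} [Ring R] [Ring R'] {ρ : A →+* R} {ρ' : A →+* R'}
    {E : Set R} {E' : Set R'} (p : R →+* R') (hρ : ∀ a, p (ρ a) = ρ' a) (hE : ∀ e ∈ E, p e ∈ E') :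
    localSubring ρ E ≤ (localSubring ρ' E').comap p := by
  refine Subring.closure_le.2 ?_
  rintro x ((⟨a, rfl⟩ | hx) | ⟨a, h1, h2⟩)
  · exact Subring.subset_closure (Or.inl (Or.inl ⟨a, (hρ a).symm⟩))
  · exact Subring.subset_closure (Or.inl (Or.inr (hE x hx)))
  · refine Subring.subset_closure (Or.inr ⟨a, ?_, ?_⟩)
    · rw [← hρ, ← map_mul, h1, map_one]
    · rw [← hρ, ← map_mul, h2, map_one]

theorem localSubring_comp_eq {R R' : Type*} [Ring R] [Ring R'] {ρ : A →+* R} {ρ' : A →+* R'}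
    {E : Set R} (p : R →+* R') (s : R' →+* R) (hp : ∀ a, p (ρ a) = ρ' a)
    (hs : ∀ a, s (ρ' a) = ρ a) (hE : ∀ e ∈ E, s (p e) = e) :
    ∀ x ∈ localSubring ρ E, s (p x) = x := by
  have : localSubring ρ E ≤ (s.comp p).eqLocus (RingHom.id R) := by
    refine Subring.closure_le.2 ?_
    rintro x ((⟨a, rfl⟩ | hx) | ⟨a, h1, h2⟩)
    · change s (p (ρ a)) = ρ a
      rw [hp, hs]
    · exact hE x hx
    · change s (p x) = x
      have e1 : s (p x) * ρ a = 1 := by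
        rw [← hs, ← hp, ← map_mul, ← map_mul, h1, map_one, map_one]
      exact left_inv_eq_right_inv e1 h2
  exact fun x hx => this hx

theorem localSubring_bijOn {R R' : Type*} [Ring R] [Ring R'] {ρ : A →+* R} {ρ' : A →+* R'}
    {C : Type*} {e : C → R} {e' : C → R'} (p : R →+* R') (s : R' →+* R) (hp : ∀ a, p (ρ a) = ρ' a)
    (hs : ∀ a, s (ρ' a) = ρ a) (hpe : ∀ c, p (e c) = e' c) (hse : ∀ c, s (e' c) = e c) :
    Set.BijOn p (localSubring ρ (Set.range e)) (localSubring ρ' (Set.range e')) := by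
  have h1 : ∀ x ∈ localSubring ρ (Set.range e), s (p x) = x :=
    localSubring_comp_eq p s hp hs (by rintro _ ⟨c, rfl⟩; rw [hpe, hse])
  have h2 : ∀ x ∈ localSubring ρ' (Set.range e'), p (s x) = x :=
    localSubring_comp_eq s p hs hp (by rintro _ ⟨c, rfl⟩; rw [hse, hpe])
  refine ⟨fun x hx => ?_, fun x hx y hy h => ?_, fun y hy => ⟨s y, ?_, h2 y hy⟩⟩
  · exact localSubring_le_comap p hp (by rintro _ ⟨c, rfl⟩; exact ⟨c, (hpe c).symm⟩) hx
  · rw [← h1 x hx, ← h1 y hy, h]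
  · exact localSubring_le_comap s hs (by rintro _ ⟨c, rfl⟩; exact ⟨c, (hse c).symm⟩) hy

/-- For a pre-completion `H = (Ĥ, ρ̂)` of `A` in `M`: the subring of the completion `End_Ĥ(Ĥ ⊗ M)`
generated over `k^ι` by `ρ̂(A)` and by `ρ̂(a)⁻¹` whenever `ρ̂(a)` is a unit. -/
def Lift.localRing (H : Lift k A M) : Subring (H.S.EndRing M) :=
  localSubring H.hom (Set.range fun c => AugAlg.EndRing.of (H.S.scal M c))

/-- The projection to the component at a lift. -/
def liftProj (H : Lift k A M) :
    LiftProd k A M →+* H.S.EndRing M := Pi.evalRingHom _ H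

/-- If `A` has a pre-completion `H` in `M`, then `O^A_M` is isomorphic, by the projection to the
component at `H`, to the subring `H.localRing` of the completion of `A` in `M`. -/
theorem localRing_preCompletion (H : Lift k A M) (hH : H.IsPreCompletion) :
    Set.BijOn (liftProj H) (localRing k A M) H.localRing := by
  choose ψ hψ using fun L => (hH L).1
  let s : H.S.EndRing M →+* LiftProd k A M :=
    RingHom.pi fun L => (ψ L).endMap M
  have hs : ∀ a, s (H.hom a) = liftHom k A M a := fun a => funext fun L => hψ L a
  have hc : ∀ c, s (AugAlg.EndRing.of (H.S.scal M c)) = liftScal k A M c :=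
    fun c => funext fun L => (ψ L).endMap_scal c
  have hp : ∀ a, liftProj H (liftHom k A M a) = H.hom a := fun _ => rfl
  have hpc : ∀ c, liftProj H (liftScal k A M c) = AugAlg.EndRing.of (H.S.scal M c) := fun _ => rfl
  exact localSubring_bijOn (R := LiftProd k A M)
    (R' := H.S.EndRing M) (C := ι → k) (ρ := liftHom k A M)
    (ρ' := H.hom) (e := liftScal k A M) (e' := fun c => AugAlg.EndRing.of (H.S.scal M c))
    (liftProj H) s hp hs hpc hc

end PreCompletion

/-! ### Functoriality of the ring of local functions -/

section Fibre

variable {k : Type u} [Field k] {I J : Type} [Fintype I] [Fintype J]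

/-- The homomorphism `k^I → k^J`, `c ↦ c ∘ f`. -/
def compHom (k : Type u) [Field k] (f : J → I) : (I → k) →ₐ[k] (J → k) :=
  AlgHom.pi fun j => Pi.evalAlgHom k (fun _ : I => k) (f j)

/-- The algebra `S ×_{k^J} k^I`, augmented over `k^I`, for a map `f : J → I`. -/
def AugAlg.fibre (S : AugAlg k J) (f : J → I) : AugAlg k I where
  carrier := AlgHom.equalizer (S.aug.comp (AlgHom.fst k S.carrier (I → k)))
    ((compHom k f).comp (AlgHom.snd k S.carrier (I → k)))
  incl := ((S.incl.comp (compHom k f)).prod (AlgHom.id k (I → k))).codRestrict _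
    fun _ => S.aug_incl _
  aug := (AlgHom.snd k S.carrier (I → k)).comp (Subalgebra.val _)
  aug_incl _ := rfl

/-- The projection `S ×_{k^J} k^I → S`. -/
def AugAlg.fibreFst (S : AugAlg k J) (f : J → I) : (S.fibre f).carrier →ₐ[k] S.carrier :=
  (AlgHom.fst k S.carrier (I → k)).comp (Subalgebra.val _)

theorem AugAlg.fibreFst_incl (S : AugAlg k J) (f : J → I) (c : I → k) :
    S.fibreFst f ((S.fibre f).incl c) = S.incl (c ∘ f) := rfl

theorem AugAlg.fibre_ext (S : AugAlg k J) (f : J → I) {x y : (S.fibre f).carrier}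
    (h1 : S.fibreFst f x = S.fibreFst f y) (h2 : (S.fibre f).aug x = (S.fibre f).aug y) : x = y :=
  Subtype.ext (Prod.ext h1 h2)

theorem AugAlg.aug_fibreFst (S : AugAlg k J) (f : J → I) (x : (S.fibre f).carrier) :
    S.aug (S.fibreFst f x) = (S.fibre f).aug x ∘ f := x.2

/-- The element `(s, c)` of the fibre product. -/
def AugAlg.fibreMk (S : AugAlg k J) (f : J → I) (s : S.carrier) (c : I → k)
    (h : S.aug s = c ∘ f) : (S.fibre f).carrier := ⟨(s, c), h⟩

theorem AugAlg.fibreFst_mem (S : AugAlg k J) (f : J → I) (n : ℕ) (x : (S.fibre f).carrier)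
    (hx : x ∈ (S.fibre f).ideal ^ n) : S.fibreFst f x ∈ S.ideal ^ n := by
  induction n generalizing x with
  | zero => rw [Submodule.pow_zero, Ideal.one_eq_top]; trivial
  | succ n ih =>
    rw [Submodule.pow_succ] at hx ⊢
    refine Submodule.mul_induction_on hx (fun r hr s hs => ?_) (fun a b ha hb => ?_)
    · rw [map_mul]
      refine Ideal.mul_mem_mul (ih r hr) ?_
      change S.aug _ = 0
      have hs' : (S.fibre f).aug s = 0 := hs
      rw [S.aug_fibreFst, hs']; rfl
    · rw [map_add]; exact add_mem ha hb

theorem AugAlg.mem_fibre_pow (S : AugAlg k J) (f : J → I) (n : ℕ) (s : S.carrier)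
    (hs : s ∈ S.ideal ^ (n + 1)) :
    ∃ h : S.aug s = (0 : I → k) ∘ f, S.fibreMk f s 0 h ∈ (S.fibre f).ideal ^ (n + 1) := by
  induction n generalizing s with
  | zero =>
    rw [zero_add, Submodule.pow_one] at hs ⊢
    exact ⟨hs, rfl⟩
  | succ n ih =>
    rw [Submodule.pow_succ] at hs
    refine Submodule.mul_induction_on hs (fun r hr t ht => ?_) (fun a b ha hb => ?_)
    · obtain ⟨h1, h2⟩ := ih r hr
      have ht' : S.aug t = (0 : I → k) ∘ f := ht
      have h3 : S.fibreMk f t 0 ht' ∈ (S.fibre f).ideal := rfl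
      have h4 : S.aug (r * t) = (0 : I → k) ∘ f := by
        rw [map_mul, ht']; exact mul_zero _
      refine ⟨h4, ?_⟩
      rw [Submodule.pow_succ]
      have := Ideal.mul_mem_mul h2 h3
      convert this using 1
      exact S.fibre_ext f rfl (mul_zero (0 : I → k)).symm
    · obtain ⟨h1, h2⟩ := ha
      obtain ⟨h3, h4⟩ := hb
      refine ⟨by rw [map_add, h1, h3]; exact add_zero _, ?_⟩
      convert add_mem h2 h4 using 1
      exact S.fibre_ext f rfl (add_zero (0 : I → k)).symm

theorem AugAlg.fibre_isComplete (S : AugAlg k J) (f : J → I) (hS : S.IsComplete) :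
    (S.fibre f).IsComplete := by
  refine ⟨fun x hx => S.fibre_ext f ?_ ?_, fun s hs => ?_⟩
  · rw [map_zero]; exact hS.1 _ fun n => S.fibreFst_mem f n x (hx n)
  · rw [map_zero]
    have := hx 1
    rwa [Submodule.pow_one] at this
  · have hs' : ∀ n, S.fibreFst f (s (n + 1)) - S.fibreFst f (s n) ∈ S.ideal ^ n := fun n => by
      rw [← map_sub]; exact S.fibreFst_mem f n _ (hs n)
    obtain ⟨x, hx⟩ := hS.2 (fun n => S.fibreFst f (s n)) hs'
    have hc : ∀ n, (S.fibre f).aug (s (n + 1)) = (S.fibre f).aug (s 1) := by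
      intro n
      induction n with
      | zero => rfl
      | succ n ih =>
        rw [← ih, ← sub_eq_zero, ← map_sub]
        have h1 : (S.fibre f).ideal ^ (n + 1) ≤ (S.fibre f).ideal := by
          rw [Submodule.pow_succ]; exact fun y hy => Submodule.mul_induction_on hy
            (fun r _ t ht => Ideal.mul_mem_left _ r ht) fun _ _ => add_mem
        exact h1 (hs (n + 1))
    have hxa : S.aug x = (S.fibre f).aug (s 1) ∘ f := by
      have h1 := hx 1
      rw [Submodule.pow_one] at h1
      have h2 : S.aug (x - S.fibreFst f (s 1)) = 0 := h1
      rw [map_sub, sub_eq_zero] at h2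
      rw [h2, S.aug_fibreFst]
    refine ⟨S.fibreMk f x _ hxa, fun n => ?_⟩
    cases n with
    | zero => rw [Submodule.pow_zero, Ideal.one_eq_top]; trivial
    | succ n =>
      obtain ⟨h1, h2⟩ := S.mem_fibre_pow f n _ (hx (n + 1))
      convert h2 using 1
      refine S.fibre_ext f (map_sub (S.fibreFst f) _ _) ?_
      rw [map_sub, hc n]
      exact sub_self _

section

variable {A B : Type u} [Ring A] [Algebra k A] [Ring B] [Algebra k B]
  {M : I → Type u} [∀ i, AddCommGroup (M i)] [∀ i, Module k (M i)] [∀ i, Module Aᵐᵒᵖ (M i)]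
  [∀ i, IsScalarTower k Aᵐᵒᵖ (M i)]
  {N : J → Type u} [∀ j, AddCommGroup (N j)] [∀ j, Module k (N j)] [∀ j, Module Bᵐᵒᵖ (N j)]
  [DecidableEq I] [DecidableEq J]
  (f : J → I) (θ : ∀ j, M (f j) ≃ₗ[k] N j)

/-- The map `(s, c) ⊗ m ↦ s ⊗ θ(m)`. -/
def AugAlg.fibreMap (S : AugAlg k J) : (S.fibre f).Tens M →+ S.Tens N :=
  AugAlg.baseMap f (S.fibreFst f) (S.fibreFst_incl f) fun j => (θ j).toLinearMap

theorem AugAlg.red_fibreMap (S : AugAlg k J) (z : (S.fibre f).Tens M) :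
    S.red N (S.fibreMap f θ z)
      = reindex f (fun j => (θ j).toLinearMap) ((S.fibre f).red M z) := by
  induction z using TensorProduct.induction_on with
  | zero => simp
  | tmul s m =>
    rw [AugAlg.fibreMap, AugAlg.baseMap_tmul, AugAlg.red_tmul, AugAlg.red_tmul, reindex_smul,
      S.aug_fibreFst]
  | add x y hx hy => simp only [map_add, hx, hy]

/-- The element `((s - π(s)) eⱼ, 0)` of the fibre product. -/
def AugAlg.fibreLow (S : AugAlg k J) (j : J) : S.carrier →+ (S.fibre f).carrier :=
  AddMonoidHom.mk' (fun s => S.fibreMk f ((s - S.incl (S.aug s)) * S.incl (Pi.single j 1)) 0 (by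
    rw [map_mul, map_sub, S.aug_incl, sub_self, zero_mul]; rfl))
    (fun s t => S.fibre_ext f (by
      change (s + t - S.incl (S.aug (s + t))) * _ = (s - S.incl (S.aug s)) * _ +
        (t - S.incl (S.aug t)) * _
      rw [map_add, map_add, ← add_mul]; congr 1; abel) (add_zero (0 : I → k)).symm)

theorem AugAlg.fibreFst_low (S : AugAlg k J) (j : J) (s : S.carrier) :
    S.fibreFst f (S.fibreLow f j s) = (s - S.incl (S.aug s)) * S.incl (Pi.single j 1) := rfl

theorem AugAlg.aug_low (S : AugAlg k J) (j : J) (s : S.carrier) :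
    (S.fibre f).aug (S.fibreLow f j s) = 0 := rfl

theorem AugAlg.fibreLow_smul (S : AugAlg k J) (j : J) (c : J → k) (s : S.carrier) :
    S.fibreLow f j (c • s) = (fun _ : I => c j) • S.fibreLow f j s := by
  rw [(S.fibre f).right_smul_def]
  refine S.fibre_ext f ?_ ?_
  · rw [map_mul, S.fibreFst_incl, S.fibreFst_low, S.fibreFst_low, S.right_smul_def, map_mul,
      S.aug_incl, map_mul, ← sub_mul, mul_assoc, mul_assoc, ← map_mul, ← map_mul,
      single_mul_comp f c j]
  · rw [map_mul, S.aug_low, S.aug_low, zero_mul]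

/-- The map `s ⊗ n ↦ ∑ⱼ ((s - π(s)) eⱼ, 0) ⊗ nⱼ`. -/
def AugAlg.fibreBack (S : AugAlg k J) : S.Tens N →+ (S.fibre f).Tens M :=
  TensorProduct.liftAddHom
    (AddMonoidHom.mk' (fun s => AddMonoidHom.mk'
        (fun n => ∑ j, S.fibreLow f j s ⊗ₜ[I → k] pick f θ n j)
        (fun m n => by simp only [pick_add, TensorProduct.tmul_add, Finset.sum_add_distrib]))
      (fun s t => DFunLike.ext _ _ fun n => by
        change ∑ j, S.fibreLow f j (s + t) ⊗ₜ[I → k] pick f θ n j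
          = ∑ j, S.fibreLow f j s ⊗ₜ[I → k] pick f θ n j
            + ∑ j, S.fibreLow f j t ⊗ₜ[I → k] pick f θ n j
        simp only [map_add, TensorProduct.add_tmul, Finset.sum_add_distrib]))
    (fun c s n => by
      change ∑ j, S.fibreLow f j (c • s) ⊗ₜ[I → k] pick f θ n j
        = ∑ j, S.fibreLow f j s ⊗ₜ[I → k] pick f θ (c • n) j
      refine Finset.sum_congr rfl fun j _ => ?_
      rw [pick_smul, S.fibreLow_smul, TensorProduct.smul_tmul])

theorem AugAlg.fibreBack_tmul (S : AugAlg k J) (s : S.carrier) (n : ∀ j, N j) :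
    (S.fibreBack f θ : S.Tens N →+ (S.fibre f).Tens M) (s ⊗ₜ[J → k] n)
      = ∑ j, S.fibreLow f j s ⊗ₜ[I → k] pick f θ n j := rfl

theorem AugAlg.red_fibreBack (S : AugAlg k J) (y : S.Tens N) :
    (S.fibre f).red M (S.fibreBack f θ y) = 0 := by
  induction y using TensorProduct.induction_on with
  | zero => simp
  | tmul s n =>
    rw [AugAlg.fibreBack_tmul, map_sum]
    refine Finset.sum_eq_zero fun j _ => ?_
    rw [AugAlg.red_tmul, S.aug_low, zero_smul]
  | add x y hx hy => simp only [map_add, hx, hy, add_zero]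

theorem AugAlg.fibreMap_fibreBack (S : AugAlg k J) (y : S.Tens N) :
    S.fibreMap f θ (S.fibreBack f θ y : (S.fibre f).Tens M)
      = y - (1 : S.carrier) ⊗ₜ[J → k] S.red N y := by
  induction y using TensorProduct.induction_on with
  | zero => simp
  | tmul s n =>
    have h : ∀ j, S.fibreMap f θ (S.fibreLow f j s ⊗ₜ[I → k] pick f θ n j)
        = ((s - S.incl (S.aug s)) * S.incl (Pi.single j 1)) ⊗ₜ[J → k] n := fun j => by
      rw [AugAlg.fibreMap, AugAlg.baseMap_tmul, S.fibreFst_low]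
      have e : ∀ t : S.carrier, t * S.incl (Pi.single j 1) = (Pi.single j 1 : J → k) •
          (t * S.incl (Pi.single j 1)) := fun t => by
        rw [S.right_smul_def, mul_assoc, ← map_mul, ← Pi.single_mul, mul_one]
      rw [e, TensorProduct.smul_tmul, single_reindex_pick, ← TensorProduct.smul_tmul]
    rw [AugAlg.fibreBack_tmul, map_sum, Finset.sum_congr rfl fun j _ => h j,
      ← TensorProduct.sum_tmul, ← Finset.mul_sum, S.sum_incl, mul_one, TensorProduct.sub_tmul,
      AugAlg.red_tmul, ← TensorProduct.smul_tmul, S.right_smul_def, one_mul]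
  | add x y hx hy => simp only [map_add, hx, hy, TensorProduct.tmul_add]; abel

theorem AugAlg.fibreBack_fibreMap (S : AugAlg k J) (z : (S.fibre f).Tens M) :
    S.fibreBack f θ (S.fibreMap f θ z)
      = z - (1 : (S.fibre f).carrier) ⊗ₜ[I → k] (S.fibre f).red M z := by
  induction z using TensorProduct.induction_on with
  | zero => simp
  | tmul s m =>
    have h : ∀ j, S.fibreLow f j (S.fibreFst f s) ⊗ₜ[I → k]
          pick f θ (reindex f (fun j => (θ j).toLinearMap) m) j
        = S.fibreLow f j (S.fibreFst f s) ⊗ₜ[I → k] m := fun j => by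
      rw [pick_reindex, ← TensorProduct.smul_tmul, (S.fibre f).right_smul_def]
      congr 1
      refine S.fibre_ext f ?_ ?_
      · rw [map_mul, S.fibreFst_incl, S.fibreFst_low, mul_assoc, ← map_mul]
        congr 2
        ext i
        by_cases h : i = j
        · subst h; simp
        · simp [Pi.single_eq_of_ne h]
      · rw [map_mul, S.aug_low, zero_mul]
    rw [AugAlg.fibreMap, AugAlg.baseMap_tmul, AugAlg.fibreBack_tmul,
      Finset.sum_congr rfl fun j _ => h j, ← TensorProduct.sum_tmul, AugAlg.red_tmul,
      ← TensorProduct.smul_tmul, (S.fibre f).right_smul_def, one_mul, ← TensorProduct.sub_tmul]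
    congr 1
    refine S.fibre_ext f ?_ ?_
    · rw [map_sum, map_sub, S.fibreFst_incl, ← S.aug_fibreFst]
      simp only [S.fibreFst_low]
      rw [← Finset.mul_sum, S.sum_incl, mul_one]
    · rw [map_sum, map_sub, (S.fibre f).aug_incl, sub_self]
      exact Finset.sum_eq_zero fun j _ => S.aug_low f j _
  | add x y hx hy => simp only [map_add, hx, hy, TensorProduct.tmul_add]; abel

/-- The map to the fibre product `(S ⊗ N) × M` is injective. -/
theorem AugAlg.fibre_inj (S : AugAlg k J) {z z' : (S.fibre f).Tens M}
    (h1 : S.fibreMap f θ z = S.fibreMap f θ z') (h2 : (S.fibre f).red M z = (S.fibre f).red M z') :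
    z = z' := by
  have e := S.fibreBack_fibreMap f θ z
  have e' := S.fibreBack_fibreMap f θ z'
  rw [h1, h2, e'] at e
  exact (sub_left_injective e).symm

/-- The additive endomorphism of `(S ×_{k^J} k^I) ⊗ M` lifting an endomorphism of `S ⊗ N`
and one of `M`. -/
def AugAlg.fibreEnd (S : AugAlg k J) (y : S.EndRing N) (x : (∀ i, M i) →+ (∀ i, M i)) :
    (S.fibre f).Tens M →+ (S.fibre f).Tens M :=
  AddMonoidHom.mk' (fun z => (1 : (S.fibre f).carrier) ⊗ₜ[I → k] x ((S.fibre f).red M z)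
      + S.fibreBack f θ (y.act (S.fibreMap f θ z)))
    (fun z z' => by
      rw [map_add, map_add, map_add, map_add, map_add, TensorProduct.tmul_add]; abel)

theorem AugAlg.red_fibreEnd (S : AugAlg k J) (y : S.EndRing N) (x : (∀ i, M i) →+ (∀ i, M i))
    (z : (S.fibre f).Tens M) :
    (S.fibre f).red M (S.fibreEnd f θ y x z) = x ((S.fibre f).red M z) := by
  change (S.fibre f).red M (_ + _) = _
  rw [map_add, AugAlg.red_fibreBack, AugAlg.red_tmul, map_one, one_smul, add_zero]

theorem AugAlg.fibreMap_fibreEnd (S : AugAlg k J) (y : S.EndRing N)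
    (x : (∀ i, M i) →+ (∀ i, M i))
    (h : ∀ z : (S.fibre f).Tens M, S.red N (y.act (S.fibreMap f θ z))
      = reindex f (fun j => (θ j).toLinearMap) (x ((S.fibre f).red M z)))
    (z : (S.fibre f).Tens M) :
    S.fibreMap f θ (S.fibreEnd f θ y x z) = y.act (S.fibreMap f θ z) := by
  change S.fibreMap f θ (_ + _) = _
  rw [map_add, AugAlg.fibreMap_fibreBack, h]
  change AugAlg.baseMap _ _ _ _ _ + _ = _
  rw [AugAlg.baseMap_tmul, map_one]
  abel

/-- The action of `a ∈ A` on `⊕ᵢ Mᵢ`. -/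
def actHom (M : I → Type u) [∀ i, AddCommGroup (M i)] [∀ i, Module Aᵐᵒᵖ (M i)] (a : A) :
    (∀ i, M i) →+ (∀ i, M i) := DistribSMul.toAddMonoidHom _ (op a)

theorem Lift.fibre_compat (φ : A →ₐ[k] B) (hθ : ∀ j a m, θ j (op a • m) = op (φ a) • θ j m)
    (L : Lift k B N) (a : A) (z : (L.S.fibre f).Tens M) :
    L.S.red N ((L.hom (φ a)).act (L.S.fibreMap f θ z))
      = reindex f (fun j => (θ j).toLinearMap) (actHom M a ((L.S.fibre f).red M z)) := by
  rw [L.red_hom, AugAlg.red_fibreMap]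
  ext j
  exact (hθ j a _).symm

/-- The component at `a` of the pull back of a lift. -/
def Lift.pullEnd (φ : A →ₐ[k] B) (hθ : ∀ j a m, θ j (op a • m) = op (φ a) • θ j m)
    (L : Lift k B N) (a : A) : (L.S.fibre f).EndRing M :=
  AugAlg.EndRing.of
    { toFun := L.S.fibreEnd f θ (L.hom (φ a)) (actHom M a)
      map_add' := map_add _
      map_smul' := fun s z => by
        refine L.S.fibre_inj f θ ?_ ?_
        · rw [L.S.fibreMap_fibreEnd f θ _ _ (L.fibre_compat f θ φ hθ a), RingHom.id_apply,
            AugAlg.fibreMap, AugAlg.baseMap_smul, AugAlg.baseMap_smul, map_smul]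
          change _ = L.S.fibreFst f s • L.S.fibreMap f θ _
          rw [L.S.fibreMap_fibreEnd f θ _ _ (L.fibre_compat f θ φ hθ a)]
          rfl
        · rw [AugAlg.red_fibreEnd, RingHom.id_apply, AugAlg.red_smul, AugAlg.red_smul,
            AugAlg.red_fibreEnd]
          ext i
          exact smul_comm (op a) ((L.S.fibre f).aug s i) _ }

theorem Lift.fibreMap_pullEnd (φ : A →ₐ[k] B)
    (hθ : ∀ j a m, θ j (op a • m) = op (φ a) • θ j m)
    (L : Lift k B N) (a : A) (z : (L.S.fibre f).Tens M) :
    L.S.fibreMap f θ ((L.pullEnd f θ φ hθ a).act z)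
      = (L.hom (φ a)).act (L.S.fibreMap f θ z) :=
  L.S.fibreMap_fibreEnd f θ _ _ (L.fibre_compat f θ φ hθ a) z

theorem Lift.red_pullEnd (φ : A →ₐ[k] B)
    (hθ : ∀ j a m, θ j (op a • m) = op (φ a) • θ j m)
    (L : Lift k B N) (a : A) (z : (L.S.fibre f).Tens M) :
    (L.S.fibre f).red M ((L.pullEnd f θ φ hθ a).act z) = op a • (L.S.fibre f).red M z :=
  L.S.red_fibreEnd f θ _ _ z

/-- A lift over `S` of the family `N` of `B`-modules gives a lift over `S ×_{k^J} k^I` of a family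
`M` of `A`-modules whose reindexing `(M_{f j})ⱼ` is isomorphic to `N` over `A`. -/
def Lift.pullback (φ : A →ₐ[k] B) (hθ : ∀ j a m, θ j (op a • m) = op (φ a) • θ j m)
    (L : Lift k B N) : Lift k A M where
  S := L.S.fibre f
  complete := L.S.fibre_isComplete f L.complete
  hom :=
    { toFun := L.pullEnd f θ φ hθ
      map_one' := AugAlg.EndRing.ext_act fun z => L.S.fibre_inj f θ
        (by rw [L.fibreMap_pullEnd, map_one, map_one]; rfl)
        (by rw [L.red_pullEnd, MulOpposite.op_one, one_smul]; rfl)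
      map_zero' := AugAlg.EndRing.ext_act fun z => L.S.fibre_inj f θ
        (by rw [L.fibreMap_pullEnd, map_zero, map_zero, AugAlg.EndRing.act_zero,
              AugAlg.EndRing.act_zero, map_zero])
        (by rw [L.red_pullEnd, MulOpposite.op_zero, zero_smul, AugAlg.EndRing.act_zero, map_zero])
      map_add' := fun a b => AugAlg.EndRing.ext_act fun z => L.S.fibre_inj f θ
        (by rw [L.fibreMap_pullEnd, map_add, map_add, AugAlg.EndRing.act_add,
              AugAlg.EndRing.act_add, map_add, L.fibreMap_pullEnd, L.fibreMap_pullEnd])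
        (by rw [L.red_pullEnd, AugAlg.EndRing.act_add, map_add, L.red_pullEnd, L.red_pullEnd,
              MulOpposite.op_add, add_smul])
      map_mul' := fun a b => AugAlg.EndRing.ext_act fun z => L.S.fibre_inj f θ
        (by rw [L.fibreMap_pullEnd, map_mul, map_mul, AugAlg.EndRing.act_mul,
              AugAlg.EndRing.act_mul, L.fibreMap_pullEnd, L.fibreMap_pullEnd])
        (by rw [L.red_pullEnd, AugAlg.EndRing.act_mul, L.red_pullEnd, L.red_pullEnd,
              MulOpposite.op_mul, mul_smul]) }
  hom_algebraMap c z := L.S.fibre_inj f θ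
    (by
      refine Eq.trans ?_ (AugAlg.baseMap_smul f (L.S.fibreFst f) (L.S.fibreFst_incl f) _ _ z).symm
      rw [AlgHom.commutes]
      refine (L.fibreMap_pullEnd f θ φ hθ (algebraMap k A c) z).trans ?_
      rw [AlgHom.commutes, L.hom_algebraMap]
      rfl)
    (by
      change (L.S.fibre f).red M ((L.pullEnd f θ φ hθ (algebraMap k A c)).act z) = _
      rw [L.red_pullEnd, AugAlg.red_smul, AlgHom.commutes]
      ext i
      exact algebraMap_smul Aᵐᵒᵖ c ((L.S.fibre f).red M z i))
  red_hom a z := L.red_pullEnd f θ φ hθ a z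

/-- The ring homomorphism of products of endomorphism rings induced by pulling back lifts. -/
def liftProdMap (φ : A →ₐ[k] B) (hθ : ∀ j a m, θ j (op a • m) = op (φ a) • θ j m) :
    LiftProd k A M →+* LiftProd k B N :=
  RingHom.pi fun L => RingHom.comp
    (AugAlg.baseRingHom f (L.S.fibreFst f) (L.S.fibreFst_incl f) θ)
    (liftProj (L.pullback f θ φ hθ))

theorem liftProdMap_liftHom (φ : A →ₐ[k] B)
    (hθ : ∀ j a m, θ j (op a • m) = op (φ a) • θ j m) (a : A) :
    liftProdMap f θ φ hθ (liftHom k A M a) = liftHom k B N (φ a) :=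
  funext fun L => AugAlg.baseRingHom_eq f (L.S.fibreFst f) (L.S.fibreFst_incl f) θ
    fun z => (L.fibreMap_pullEnd f θ φ hθ a z).symm

theorem liftProdMap_liftScal (φ : A →ₐ[k] B)
    (hθ : ∀ j a m, θ j (op a • m) = op (φ a) • θ j m) (c : I → k) :
    liftProdMap f θ φ hθ (liftScal k A M c) = liftScal k B N (c ∘ f) :=
  funext fun L => AugAlg.baseRingHom_eq f (L.S.fibreFst f) (L.S.fibreFst_incl f) θ
    fun z => (AugAlg.baseMap_scal f (L.S.fibreFst f) (L.S.fibreFst_incl f) _ c z).symm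

end

end Fibre

section Comparison

variable {k : Type u} [Field k] {I J : Type} [Fintype I] [Fintype J]
  {A B : Type u} [Ring A] [Algebra k A] [Ring B] [Algebra k B]
  {M : I → Type u} [∀ i, AddCommGroup (M i)] [∀ i, Module k (M i)] [∀ i, Module Aᵐᵒᵖ (M i)]
  {N : J → Type u} [∀ j, AddCommGroup (N j)] [∀ j, Module k (N j)] [∀ j, Module Bᵐᵒᵖ (N j)]

/-- The ring homomorphism `g : O^A_M → O^B_N` is compatible with `φ : A → B` and with the
homomorphism `k^I → k^J`, `c ↦ c ∘ f`. -/
structure IsComparison (φ : A →ₐ[k] B) (f : J → I)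
    (g : localRing k A M →+* localRing k B N) : Prop where
  map_toLocalRing : ∀ a, g (toLocalRing k M a) = toLocalRing k N (φ a)
  map_scalLocalRing : ∀ c, g (scalLocalRing k A M c) = scalLocalRing k B N (c ∘ f)

theorem localSubring_comap_top {A R : Type*} [Ring A] [Ring R] (ρ : A →+* R) (E : Set R)
    {T : Subring (localSubring ρ E)} (h1 : ∀ a, ∀ h, ⟨ρ a, h⟩ ∈ T) (h2 : ∀ e ∈ E, ∀ h, ⟨e, h⟩ ∈ T)
    (h3 : ∀ (x y : localSubring ρ E), y.1 ∈ Set.range ρ → x * y = 1 → y * x = 1 → x ∈ T) :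
    T = ⊤ := by
  refine top_unique fun x _ => ?_
  obtain ⟨x, hx⟩ := x
  have : localSubring ρ E ≤ T.map (localSubring ρ E).subtype := by
    refine Subring.closure_le.2 ?_
    intro x hx'
    have hxm : x ∈ localSubring ρ E := Subring.subset_closure hx'
    refine ⟨⟨x, hxm⟩, ?_, rfl⟩
    rcases hx' with (⟨a, rfl⟩ | hx') | ⟨a, e1, e2⟩
    · exact h1 a _
    · exact h2 x hx' _
    · exact h3 _ ⟨ρ a, Subring.subset_closure (Or.inl (Or.inl ⟨a, rfl⟩))⟩ ⟨a, rfl⟩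
        (Subtype.ext e1) (Subtype.ext e2)
  obtain ⟨y, hy, rfl⟩ := this hx
  exact hy

theorem IsComparison.unique {φ : A →ₐ[k] B} {f : J → I}
    {g g' : localRing k A M →+* localRing k B N} (hg : IsComparison φ f g)
    (hg' : IsComparison φ f g') : g = g' := by
  have : g.eqLocus g' = ⊤ := by
    refine localSubring_comap_top (liftHom k A M) (Set.range (liftScal k A M)) ?_ ?_ ?_
    · intro a h
      exact (hg.map_toLocalRing a).trans (hg'.map_toLocalRing a).symm
    · rintro _ ⟨c, rfl⟩ h
      exact (hg.map_scalLocalRing c).trans (hg'.map_scalLocalRing c).symm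
    · rintro (x : localRing k A M) ⟨_, hy⟩ ⟨a, rfl⟩ e1 e2
      replace e1 : x * toLocalRing k M a = 1 := e1
      replace e2 : toLocalRing k M a * x = 1 := e2
      have ha : g (toLocalRing k M a) = g' (toLocalRing k M a) :=
        (hg.map_toLocalRing a).trans (hg'.map_toLocalRing a).symm
      have e1' : g x * g (toLocalRing k M a) = 1 := by
        rw [← map_mul, e1, map_one]
      have e2' : g' (toLocalRing k M a) * g' x = 1 := by
        rw [← map_mul, e2, map_one]
      rw [← ha] at e2'
      exact (left_inv_eq_right_inv e1' e2' : g x = g' x)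
  ext x : 1
  exact (this ▸ Subring.mem_top x : x ∈ g.eqLocus g')

theorem exists_isComparison [∀ i, IsScalarTower k Aᵐᵒᵖ (M i)] (φ : A →ₐ[k] B) (f : J → I)
    (h : ∀ j, ∃ θ : M (f j) ≃ₗ[k] N j, ∀ a m, θ (op a • m) = op (φ a) • θ m) :
    ∃ g : localRing k A M →+* localRing k B N, IsComparison φ f g := by
  classical
  choose θ hθ using h
  have hle : localRing k A M ≤ (localRing k B N).comap (liftProdMap f θ φ hθ) := by
    refine Subring.closure_le.2 ?_
    rintro x ((⟨a, rfl⟩ | ⟨c, rfl⟩) | ⟨a, e1, e2⟩)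
    · refine Subring.subset_closure (Or.inl (Or.inl ⟨φ a, ?_⟩))
      exact (liftProdMap_liftHom f θ φ hθ a).symm
    · refine Subring.subset_closure (Or.inl (Or.inr ⟨c ∘ f, ?_⟩))
      exact (liftProdMap_liftScal f θ φ hθ c).symm
    · refine Subring.subset_closure (Or.inr ⟨φ a, ?_, ?_⟩)
      · rw [← liftProdMap_liftHom f θ φ hθ a, ← map_mul, e1, map_one]
      · rw [← liftProdMap_liftHom f θ φ hθ a, ← map_mul, e2, map_one]
  refine ⟨((liftProdMap f θ φ hθ).comp (localRing k A M).subtype).codRestrict _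
    fun x => hle x.2, fun a => Subtype.ext ?_, fun c => Subtype.ext ?_⟩
  · exact liftProdMap_liftHom f θ φ hθ a
  · exact liftProdMap_liftScal f θ φ hθ c

end Comparison

/-! ### The ringed space `aSpec A` -/

section Space

variable (k A : Type u) [Field k] [Ring A] [Algebra k A]

/-- The contraction of right modules along a homomorphism `φ : A → B`; right `A`-modules are modules
over `Aᵐᵒᵖ`. -/
noncomputable abbrev contractionFunctor {k A B : Type u} [Field k] [Ring A] [Algebra k A] [Ring B] [Algebra k B]
    (φ : A →ₐ[k] B) : ModuleCat.{u} Bᵐᵒᵖ ⥤ ModuleCat.{u} Aᵐᵒᵖ :=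
  ModuleCat.restrictScalars (RingHom.op φ.toRingHom)

variable {A} in
/-- A right `A`-module is aprime if it is (isomorphic to) the contraction of a simple right
`B`-module along some homomorphism `f : A → B`. -/
def IsAprime (P : ModuleCat.{u} Aᵐᵒᵖ) : Prop :=
  ∃ (B : Type u) (_ : Ring B) (_ : Algebra k B) (f : A →ₐ[k] B) (N : ModuleCat.{u} Bᵐᵒᵖ),
    IsSimpleModule Bᵐᵒᵖ N ∧ Nonempty (P ≅ (contractionFunctor f).obj N)

/-- Isomorphism of aprime modules. -/
def aprimeSetoid : Setoid {P : ModuleCat.{u} Aᵐᵒᵖ // IsAprime k P} :=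
  (isIsomorphicSetoid (ModuleCat.{u} Aᵐᵒᵖ)).comap Subtype.val

/-- The points of `aSpec A`: the isomorphism classes of right aprime `A`-modules. -/
def Pt : Type (u + 1) := Quotient (aprimeSetoid k A)

variable {k A}

/-- A module representing a point of `aSpec A`. -/
noncomputable def Pt.rep (P : Pt k A) : ModuleCat.{u} Aᵐᵒᵖ :=
  (@Quotient.out _ (aprimeSetoid k A) P).1

/-- The underlying set of a module representing a point of `aSpec A`. -/
def Pt.Mod (P : Pt k A) : Type u := P.rep

noncomputable instance (P : Pt k A) : AddCommGroup P.Mod := inferInstanceAs (AddCommGroup P.rep)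

noncomputable instance (P : Pt k A) : Module Aᵐᵒᵖ P.Mod := inferInstanceAs (Module Aᵐᵒᵖ P.rep)

noncomputable instance (P : Pt k A) : Module k P.Mod := Module.compHom _ (algebraMap k Aᵐᵒᵖ)

instance (P : Pt k A) : IsScalarTower k Aᵐᵒᵖ P.Mod :=
  IsScalarTower.of_algebraMap_smul fun _ _ => rfl

/-- `D(f)`: the points on whose modules `f` acts injectively. -/
def basicSet (f : A) : Set (Pt k A) := {P | Function.Injective fun m : P.Mod => op f • m}

/-- The topology of `aSpec A`, generated by the sets `D(f)`. -/
instance : TopologicalSpace (Pt k A) :=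
  TopologicalSpace.generateFrom (Set.range (basicSet (k := k) (A := A)))

variable {B : Type u} [Ring B] [Algebra k B]

theorem IsAprime.contraction (φ : A →ₐ[k] B) {P : ModuleCat.{u} Bᵐᵒᵖ} (h : IsAprime k P) :
    IsAprime k ((contractionFunctor φ).obj P) := by
  obtain ⟨C, _, _, f, N, hN, ⟨e⟩⟩ := h
  exact ⟨C, _, _, f.comp φ, N, hN, ⟨(contractionFunctor φ).mapIso e⟩⟩

/-- The map `aSpec B → aSpec A` which sends an aprime `B`-module to its contraction. -/
noncomputable def contraction (φ : A →ₐ[k] B) : Pt k B → Pt k A :=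
  Quotient.map (sa := aprimeSetoid k B) (sb := aprimeSetoid k A)
    (fun P => ⟨(contractionFunctor φ).obj P.1, P.2.contraction φ⟩)
    fun _ _ ⟨e⟩ => ⟨(contractionFunctor φ).mapIso e⟩

/-- The ring `O^A_P` for a finite family `P` of points of `aSpec A`. -/
noncomputable abbrev localRingAt {n : ℕ} (P : Fin n → Pt k A) : Subring (LiftProd k A fun i => (P i).Mod) :=
  localRing k A fun i => (P i).Mod

theorem exists_restrict {n m : ℕ} (P : Fin n → Pt k A) (f : Fin m → Fin n) :
    ∃ g : localRingAt P →+* localRingAt (P ∘ f), IsComparison (AlgHom.id k A) f g :=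
  exists_isComparison (AlgHom.id k A) f fun _ => ⟨LinearEquiv.refl k _, fun _ _ => rfl⟩

/-- The canonical homomorphism `O^A_P → O^A_{P ∘ f}`, determined by being compatible with the
homomorphisms from `A` and with `k^n → k^m`, `c ↦ c ∘ f`.  For injective `f` it belongs to the
projection of `⊕ᵢ Pᵢ` to a partial sum. -/
noncomputable def restrict {n m : ℕ} (P : Fin n → Pt k A) (f : Fin m → Fin n) :
    localRingAt P →+* localRingAt (P ∘ f) := (exists_restrict P f).choose

theorem isComparison_restrict {n m : ℕ} (P : Fin n → Pt k A) (f : Fin m → Fin n) :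
    IsComparison (AlgHom.id k A) f (restrict P f) := (exists_restrict P f).choose_spec

/-- The finite families of points of `U`. -/
structure Fam (U : Set (Pt k A)) : Type (u + 1) where
  n : ℕ
  pt : Fin n → Pt k A
  mem : ∀ i, pt i ∈ U

/-- The limit of the rings `O^A_P` over the finite families `P` of points of `U`: the families of
elements that are compatible with the canonical homomorphisms. -/
noncomputable def limitRing (U : Set (Pt k A)) : Subring (∀ P : Fam U, localRingAt P.pt) where
  carrier := {s | ∀ (P : Fam U) (m : ℕ) (f : Fin m → Fin P.n),
    s ⟨m, P.pt ∘ f, fun i => P.mem (f i)⟩ = restrict P.pt f (s P)}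
  mul_mem' hs ht P m f := by simp only [Pi.mul_apply, hs P m f, ht P m f, map_mul]
  one_mem' P m f := by simp only [Pi.one_apply, map_one]
  add_mem' hs ht P m f := by simp only [Pi.add_apply, hs P m f, ht P m f, map_add]
  zero_mem' P m f := by simp only [Pi.zero_apply, map_zero]
  neg_mem' hs P m f := by simp only [Pi.neg_apply, hs P m f, map_neg]

/-- Restriction of families of local functions. -/
noncomputable def limitRingRes {U V : Set (Pt k A)} (h : V ⊆ U) : limitRing U →+* limitRing V where
  toFun s := ⟨fun P => s.1 ⟨P.n, P.pt, fun i => h (P.mem i)⟩,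
    fun P m f => s.2 ⟨P.n, P.pt, fun i => h (P.mem i)⟩ m f⟩
  map_one' := rfl
  map_mul' _ _ := rfl
  map_zero' := rfl
  map_add' _ _ := rfl

variable (k A)

/-- The topological space `aSpec A`. -/
abbrev aSpecTop : TopCat.{u + 1} := TopCat.of (Pt k A)

variable {k A} in
/-- An open subset of `aSpec A` as a set of points. -/
def ptSet (U : TopologicalSpace.Opens (aSpecTop k A)) : Set (Pt k A) := {P | P ∈ U.carrier}

/-- The presheaf `U ↦ lim O^A_P` on `aSpec A`. -/
noncomputable def localPresheaf : TopCat.Presheaf RingCat.{u + 1} (aSpecTop k A) where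
  obj U := RingCat.of (limitRing (ptSet U.unop))
  map i := RingCat.ofHom (limitRingRes (leOfHom i.unop))
  map_id _ := rfl
  map_comp _ _ := rfl

/-- The ringed space `aSpec A`; its structure sheaf is the sheaf associated to `localPresheaf`. -/
noncomputable def aSpec : AlgebraicGeometry.SheafedSpace RingCat.{u + 1} where
  carrier := aSpecTop k A
  presheaf := sheafify (Opens.grothendieckTopology (aSpecTop k A)) (localPresheaf k A)
  IsSheaf := ((presheafToSheaf (Opens.grothendieckTopology (aSpecTop k A)) RingCat.{u + 1}).obj
    (localPresheaf k A)).property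

/-- The canonical morphism from the presheaf to the structure sheaf. -/
noncomputable def toStructureSheaf : localPresheaf k A ⟶ (aSpec k A).presheaf :=
  toSheafify (Opens.grothendieckTopology (aSpecTop k A)) (localPresheaf k A)

variable {k A}

/-- The morphism of ringed spaces `G : aSpec B → aSpec A` is induced by `φ : A → B`: on points it is
the contraction, and on structure sheaves it extends a morphism `τ` of presheaves which is given, at
every finite family `P` of points, by a homomorphism `O^A_{Pᶜ} → O^B_P` compatible with `φ`. -/
def IsInduced (φ : A →ₐ[k] B) (G : aSpec k B ⟶ aSpec k A) : Prop :=
  (∀ P : Pt k B, (ConcreteCategory.hom G.hom.base : Pt k B → Pt k A) P = contraction φ P) ∧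
  ∃ τ : localPresheaf k A ⟶
      (TopCat.Presheaf.pushforward RingCat.{u + 1} G.hom.base).obj (localPresheaf k B),
    (∀ (U : TopologicalSpace.Opens (aSpecTop k A))
        (s : limitRing (ptSet U)) (n : ℕ) (P : Fin n → Pt k B)
        (hB : ∀ i, P i ∈ ptSet ((TopologicalSpace.Opens.map G.hom.base).obj U))
        (hA : ∀ i, contraction φ (P i) ∈ ptSet U),
      ∃ g : localRingAt (contraction φ ∘ P) →+* localRingAt P,
        IsComparison φ id g ∧
        ((τ.app (Opposite.op U)).hom s :
            limitRing (ptSet ((TopologicalSpace.Opens.map G.hom.base).obj U))).1 ⟨n, P, hB⟩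
          = g (s.1 ⟨n, contraction φ ∘ P, hA⟩)) ∧
    toStructureSheaf k A ≫ G.hom.c =
      τ ≫ (TopCat.Presheaf.pushforward RingCat.{u + 1} G.hom.base).map (toStructureSheaf k B)

end Space

end AssocScheme

namespace AssocScheme

section Functoriality

variable {k A B C : Type u} [Field k] [Ring A] [Algebra k A] [Ring B] [Algebra k B]
  [Ring C] [Algebra k C]

/-! The whole statement rests on one rigidity property. The ring of local functions is generated by
the image of `A`, by `k^n`, and by two-sided inverses of elements of that image. A homomorphism out
of it is therefore fixed by its values on `A` and on `k^n`, since inverses have forced images. This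
is `IsComparison.unique`.

Existence comes from `exists_isComparison`. Since the local ring is computed in all lifts at once,
it suffices to turn lifts of the `B`-modules into lifts of the `A`-modules. A lift over `S` pulls
back to one over the fibre product `S ×_{k^J} k^I`, and base change along the projection to `S`
returns the original lift composed with `φ`. No pre-completion has to exist. For points of `aSpec B`
the only further input is that the representative of a contracted point is isomorphic over `A` to
the contraction of the representative (`exists_contraction_equiv`).

Everything else is rigidity combined with the universal property of sheafification. Comparisons
commute with the transition maps of the limit because both composites are compatible with the same
data (`restrict_comparison`), which gives a map of presheaves. Composed with sheafification on the
side of `B`, it has a sheaf as target and so factors uniquely through the structure sheaf of `aSpec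
A`. A morphism induced by `φ` is unique (`IsInduced.unique`), so functoriality reduces to checking
that identities and composites are again induced (`isInduced_id`, `IsInduced.comp`). -/

theorem IsComparison.comp {I J L : Type} [Fintype I] [Fintype J] [Fintype L]
    {M : I → Type u} [∀ i, AddCommGroup (M i)] [∀ i, Module k (M i)] [∀ i, Module Aᵐᵒᵖ (M i)]
    {N : J → Type u} [∀ j, AddCommGroup (N j)] [∀ j, Module k (N j)] [∀ j, Module Bᵐᵒᵖ (N j)]
    {Q : L → Type u} [∀ l, AddCommGroup (Q l)] [∀ l, Module k (Q l)] [∀ l, Module Cᵐᵒᵖ (Q l)]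
    {φ : A →ₐ[k] B} {ψ : B →ₐ[k] C} {f : J → I} {f' : L → J}
    {g : localRing k A M →+* localRing k B N} {g' : localRing k B N →+* localRing k C Q}
    (hg : IsComparison φ f g) (hg' : IsComparison ψ f' g') :
    IsComparison (ψ.comp φ) (f ∘ f') (g'.comp g) where
  map_toLocalRing a := by
    rw [RingHom.comp_apply, hg.map_toLocalRing, hg'.map_toLocalRing, AlgHom.comp_apply]
  map_scalLocalRing c := by
    rw [RingHom.comp_apply, hg.map_scalLocalRing, hg'.map_scalLocalRing, Function.comp_assoc]

theorem IsComparison.id {I : Type} [Fintype I]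
    {M : I → Type u} [∀ i, AddCommGroup (M i)] [∀ i, Module k (M i)] [∀ i, Module Aᵐᵒᵖ (M i)] :
    IsComparison (AlgHom.id k A) _root_.id (RingHom.id (localRing k A M)) :=
  ⟨fun _ => rfl, fun _ => rfl⟩

/-! ### Representatives of contracted points and the comparison homomorphisms -/

/-- The module representing the contraction of a point is the contraction of the module
representing this point. -/
theorem contraction_rep_iso (φ : A →ₐ[k] B) (P : Pt k B) :
    Nonempty ((contraction φ P).rep ≅ (contractionFunctor φ).obj P.rep) := by
  have h : contraction φ P = Quotient.mk (aprimeSetoid k A)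
      ⟨(contractionFunctor φ).obj P.rep,
        (@Quotient.out _ (aprimeSetoid k B) P).2.contraction φ⟩ := by
    -- Writing `P` as the class of its chosen representative lets `Quotient.map` compute.
    conv_lhs => rw [← @Quotient.out_eq _ (aprimeSetoid k B) P]
    rfl
  exact @Quotient.exact _ (aprimeSetoid k A) _ _ ((@Quotient.out_eq _ (aprimeSetoid k A) _).trans h)

/-- Each point carries its own chosen representative, so the two modules are isomorphic but not
equal. The isomorphism, read through the contraction, is exactly the semilinearity that
`exists_isComparison` asks for. -/
theorem exists_contraction_equiv (φ : A →ₐ[k] B) (P : Pt k B) :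
    ∃ θ : (contraction φ P).Mod ≃ₗ[k] P.Mod, ∀ a m, θ (op a • m) = op (φ a) • θ m := by
  obtain ⟨e⟩ := contraction_rep_iso φ P
  have h : ∀ (a : A) (m : (contraction φ P).rep),
      e.toLinearEquiv (op a • m) = (op a • e.toLinearEquiv m) :=
    fun a m => map_smul e.toLinearEquiv (op a) m
  let θ : (contraction φ P).Mod ≃+ P.Mod := e.toLinearEquiv.toAddEquiv
  have hθ : ∀ (a : A) m, θ (op a • m) = op (φ a) • θ m := h
  refine ⟨{ θ with map_smul' := fun c m => ?_ }, hθ⟩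
  -- `k` acts on both modules through the structure maps of `A` and `B`, which `φ` respects, so
  -- semilinearity at scalars is `k`-linearity.
  have := hθ (algebraMap k A c) m
  rw [AlgHom.commutes] at this
  exact this

theorem existsUnique_isComparison (φ : A →ₐ[k] B) {n : ℕ} (P : Fin n → Pt k B) :
    ∃! g : localRingAt (contraction φ ∘ P) →+* localRingAt P, IsComparison φ id g := by
  obtain ⟨g, hg⟩ := exists_isComparison (M := fun i => ((contraction φ ∘ P) i).Mod)
    (N := fun i => (P i).Mod) φ id fun j => exists_contraction_equiv φ (P j)
  exact ⟨g, hg, fun g' hg' => hg'.unique hg⟩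

/-- The homomorphism `O^A_{Pᶜ} → O^B_P` compatible with `φ : A → B`. -/
noncomputable def comparison (φ : A →ₐ[k] B) {n : ℕ} (P : Fin n → Pt k B) :
    localRingAt (contraction φ ∘ P) →+* localRingAt P := (existsUnique_isComparison φ P).choose

theorem isComparison_comparison (φ : A →ₐ[k] B) {n : ℕ} (P : Fin n → Pt k B) :
    IsComparison φ id (comparison φ P) := (existsUnique_isComparison φ P).choose_spec.1

/-- Both ways round the square are compatible with `φ` and with `c ↦ c ∘ f`, so rigidity makes them
equal. This is what lets the comparisons pass to the limit over finite families. -/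
theorem restrict_comparison (φ : A →ₐ[k] B) {n m : ℕ} (P : Fin n → Pt k B) (f : Fin m → Fin n)
    (x : localRingAt (contraction φ ∘ P)) :
    restrict P f (comparison φ P x)
      = comparison φ (P ∘ f) (restrict (contraction φ ∘ P) f x) := by
  have h1 := (isComparison_comparison φ P).comp (isComparison_restrict P f)
  have h2 := (isComparison_restrict (contraction φ ∘ P) f).comp
    (isComparison_comparison φ (P ∘ f))
  -- The two compatibilities are about `id.comp φ` and `φ.comp id`, and about `id ∘ f` and `f ∘ id`;
  -- these agree definitionally.
  exact congrArg (fun g : localRingAt (contraction φ ∘ P) →+* localRingAt (P ∘ f) => g x)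
    (h1.unique h2)

/-! ### The contraction on points: continuity and functoriality -/

theorem mem_basicSet_contraction (φ : A →ₐ[k] B) (P : Pt k B) (a : A) :
    contraction φ P ∈ basicSet a ↔ P ∈ basicSet (φ a) := by
  obtain ⟨θ, hθ⟩ := exists_contraction_equiv φ P
  have h : (fun m : P.Mod => op (φ a) • m) ∘ θ
      = θ ∘ fun m : (contraction φ P).Mod => op a • m := funext fun m => (hθ a m).symm
  change Function.Injective _ ↔ Function.Injective _
  -- Composing with the bijection `θ` on either side does not affect injectivity, and `h` identifies
  -- the two composites.
  rw [← θ.bijective.1.of_comp_iff, ← h, Function.Injective.of_comp_iff' _ θ.bijective]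

/-- The preimage of a generating open set `D(a)` is the generating open set `D(φ a)`. -/
theorem continuous_contraction (φ : A →ₐ[k] B) :
    Continuous (contraction φ : Pt k B → Pt k A) := by
  refine continuous_generateFrom_iff.2 ?_
  rintro _ ⟨a, rfl⟩
  refine TopologicalSpace.isOpen_generateFrom_of_mem ⟨φ a, ?_⟩
  ext P
  exact (mem_basicSet_contraction φ P a).symm

/-- Restriction of scalars along the identity is isomorphic to the identity functor, and points are
isomorphism classes. The equality is thus propositional and not definitional, which forces the
transports in `isInduced_id`; the same holds for `contraction_comp` and `IsInduced.comp`. -/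
theorem contraction_id (P : Pt k A) : contraction (AlgHom.id k A) P = P := by
  refine Quotient.inductionOn P fun P => ?_
  exact Quotient.sound (s := aprimeSetoid k A) ⟨(ModuleCat.restrictScalarsId'App
    (RingHom.op (AlgHom.id k A).toRingHom) rfl P.1)⟩

theorem contraction_comp (φ : A →ₐ[k] B) (ψ : B →ₐ[k] C) (P : Pt k C) :
    contraction (ψ.comp φ) P = contraction φ (contraction ψ P) := by
  refine Quotient.inductionOn P fun P => ?_
  exact Quotient.sound (s := aprimeSetoid k A) ⟨(ModuleCat.restrictScalarsComp'App
    (RingHom.op φ.toRingHom) (RingHom.op ψ.toRingHom)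
    (RingHom.op (ψ.comp φ).toRingHom) rfl P.1)⟩

/-! ### The maps of presheaves and of structure sheaves -/

/-- The homomorphism `lim O^A_Q → lim O^B_P` over the finite families `Q` of points of `U` and `P`
of points of a set `V` contracting into `U`. -/
noncomputable def limitRingMap (φ : A →ₐ[k] B) {U : Set (Pt k A)} {V : Set (Pt k B)}
    (h : ∀ P ∈ V, contraction φ P ∈ U) : limitRing U →+* limitRing V where
  toFun s := ⟨fun P => comparison φ P.pt (s.1 ⟨P.n, contraction φ ∘ P.pt, fun i => h _ (P.mem i)⟩),
    fun P m f => by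
      -- Once the comparison is moved past the restriction, what remains is the compatibility of `s`
      -- at the contracted family.
      rw [restrict_comparison, ← s.2 ⟨P.n, contraction φ ∘ P.pt, fun i => h _ (P.mem i)⟩ m f]
      rfl⟩
  map_one' := Subtype.ext <| funext fun P => map_one (comparison φ P.pt)
  map_mul' _ _ := Subtype.ext <| funext fun P => map_mul (comparison φ P.pt) _ _
  map_zero' := Subtype.ext <| funext fun P => map_zero (comparison φ P.pt)
  map_add' _ _ := Subtype.ext <| funext fun P => map_add (comparison φ P.pt) _ _

/-- The contraction as a continuous map. -/
noncomputable def contractionTop (φ : A →ₐ[k] B) : aSpecTop k B ⟶ aSpecTop k A :=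
  TopCat.ofHom ⟨contraction φ, continuous_contraction φ⟩

/-- The morphism of presheaves given by the homomorphisms `O^A_{Pᶜ} → O^B_P`. -/
noncomputable def presheafMap (φ : A →ₐ[k] B) : localPresheaf k A ⟶
    (TopCat.Presheaf.pushforward RingCat.{u + 1} (contractionTop φ)).obj (localPresheaf k B) where
  app U := RingCat.ofHom (limitRingMap φ (U := ptSet U.unop)
    (V := ptSet ((TopologicalSpace.Opens.map (contractionTop φ)).obj U.unop)) fun _ h => h)
  naturality _ _ _ := rfl

/-- Sheafification is universal only for maps into sheaves; this supplies the target for both the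
construction and the uniqueness of the map on structure sheaves. -/
theorem pushforward_isSheaf (A : Type u) [Ring A] [Algebra k A] {X : TopCat.{u + 1}}
    (b : aSpecTop k A ⟶ X) :
    Presheaf.IsSheaf (Opens.grothendieckTopology X)
      ((TopCat.Presheaf.pushforward RingCat.{u + 1} b).obj (aSpec k A).presheaf) :=
  TopCat.Sheaf.pushforward_sheaf_of_sheaf b (aSpec k A).IsSheaf

/-- The morphism of ringed spaces `aSpec B → aSpec A` induced by `φ : A → B`. -/
noncomputable def aSpecMap (φ : A →ₐ[k] B) : aSpec k B ⟶ aSpec k A :=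
  InducedCategory.homMk
    { base := contractionTop φ
      c := sheafifyLift (Opens.grothendieckTopology (aSpecTop k A))
        (presheafMap φ ≫ (TopCat.Presheaf.pushforward RingCat.{u + 1} (contractionTop φ)).map
          (toStructureSheaf k B)) (pushforward_isSheaf B (contractionTop φ)) }

theorem isInduced_aSpecMap (φ : A →ₐ[k] B) : IsInduced φ (aSpecMap φ) :=
  ⟨fun _ => rfl, presheafMap φ,
    fun _ _ _ P _ _ => ⟨comparison φ P, isComparison_comparison φ P, rfl⟩,
    toSheafify_sheafifyLift (Opens.grothendieckTopology (aSpecTop k A)) _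
      (pushforward_isSheaf B (contractionTop φ))⟩

/-! ### Uniqueness of the induced morphism, identities and composites -/

/-- The data are determined layer by layer: the base map by its points, the presheaf map by rigidity
of the comparison at every finite family, and the map of structure sheaves by its composite with the
canonical map to the sheafification. -/
theorem IsInduced.unique {φ : A →ₐ[k] B} {G G' : aSpec k B ⟶ aSpec k A}
    (h : IsInduced φ G) (h' : IsInduced φ G') : G = G' := by
  obtain ⟨⟨b, c⟩⟩ := G
  obtain ⟨⟨b', c'⟩⟩ := G'
  obtain ⟨hb, τ, hτ, hc⟩ := h
  obtain ⟨hb', τ', hτ', hc'⟩ := h'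
  -- The base maps must be identified first: only then do `τ`, `τ'` and `c`, `c'` have the same
  -- targets.
  obtain rfl : b = b' := TopCat.hom_ext (ContinuousMap.ext fun P => (hb P).trans (hb' P).symm)
  have e : τ = τ' := by
    refine NatTrans.ext (funext fun U => RingCat.hom_ext (RingHom.ext fun s => ?_))
    -- A section of the limit is determined by its values at the finite families.
    refine Subtype.ext (funext fun P => ?_)
    obtain ⟨n, P, hP⟩ := P
    have hA : ∀ i, contraction φ (P i) ∈ ptSet U.unop := fun i => hb (P i) ▸ hP i
    obtain ⟨g, hg, e⟩ := hτ U.unop s n P hP hA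
    obtain ⟨g', hg', e'⟩ := hτ' U.unop s n P hP hA
    rw [hg.unique hg'] at e
    exact e.trans e'.symm
  have ec : c = c' := by
    -- Two maps from a sheafification into a sheaf agree as soon as they agree on the presheaf,
    -- where both are `τ` followed by the pushed forward canonical map.
    refine sheafify_hom_ext (Opens.grothendieckTopology (aSpecTop k A)) _ _
      (pushforward_isSheaf B b) ?_
    exact hc.trans ((congrArg (fun t => t ≫ _) e).trans hc'.symm)
  rw [ec]

/-- The identity of the presheaf serves as `τ`; the only difficulty is that the family contracted
along the identity is equal to `P` merely propositionally. -/
theorem isInduced_id (A : Type u) [Ring A] [Algebra k A] :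
    IsInduced (AlgHom.id k A) (𝟙 (aSpec k A)) := by
  refine ⟨fun P => (contraction_id P).symm, 𝟙 (localPresheaf k A), fun U s n P hB hA => ?_, ?_⟩
  · change ∃ g : localRingAt (contraction (AlgHom.id k A) ∘ P) →+* localRingAt P,
      IsComparison (AlgHom.id k A) id g ∧ s.1 ⟨n, P, hB⟩ = g (s.1 ⟨n, _, hA⟩)
    have e : contraction (AlgHom.id k A) ∘ P = P := funext fun i => contraction_id (P i)
    -- Restating membership for the composite family makes that family a single term, which can then
    -- be generalized to a variable `Q` and replaced by `P`.
    have hA' : ∀ i, (contraction (AlgHom.id k A) ∘ P) i ∈ ptSet U := hA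
    change ∃ g : localRingAt (contraction (AlgHom.id k A) ∘ P) →+* localRingAt P,
      IsComparison (AlgHom.id k A) id g ∧ s.1 ⟨n, P, hB⟩ = g (s.1 ⟨n, _, hA'⟩)
    clear hA
    generalize contraction (AlgHom.id k A) ∘ P = Q at e hA'
    subst e
    exact ⟨RingHom.id _, IsComparison.id, rfl⟩
  · rfl

/-- The first square is pasted with the pushforward along `b` of the second. Keeping the iterated
pushforward and arbitrary presheaves leaves the identification with the pushforward along the
composite map to the place of use. -/
theorem pushforward_comp_square {X Y Z : TopCat.{u + 1}} (b : Y ⟶ X) (b' : Z ⟶ Y)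
    {F F' : X.Presheaf RingCat.{u + 1}} {E E' : Y.Presheaf RingCat.{u + 1}}
    {D D' : Z.Presheaf RingCat.{u + 1}} {η : F ⟶ F'} {ε : E ⟶ E'} {δ : D ⟶ D'}
    {c : F' ⟶ (TopCat.Presheaf.pushforward RingCat.{u + 1} b).obj E'}
    {c' : E' ⟶ (TopCat.Presheaf.pushforward RingCat.{u + 1} b').obj D'}
    {τ : F ⟶ (TopCat.Presheaf.pushforward RingCat.{u + 1} b).obj E}
    {τ' : E ⟶ (TopCat.Presheaf.pushforward RingCat.{u + 1} b').obj D}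
    (h : η ≫ c = τ ≫ (TopCat.Presheaf.pushforward RingCat.{u + 1} b).map ε)
    (h' : ε ≫ c' = τ' ≫ (TopCat.Presheaf.pushforward RingCat.{u + 1} b').map δ) :
    η ≫ c ≫ (TopCat.Presheaf.pushforward RingCat.{u + 1} b).map c' =
      (τ ≫ (TopCat.Presheaf.pushforward RingCat.{u + 1} b).map τ') ≫
        (TopCat.Presheaf.pushforward RingCat.{u + 1} b).map
          ((TopCat.Presheaf.pushforward RingCat.{u + 1} b').map δ) := by
  rw [← Category.assoc, h, Category.assoc, ← Functor.map_comp, h', Functor.map_comp,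
    Category.assoc]

/-- At a family `P` the value passes through the intermediate family `contraction ψ ∘ P`, and a
composite of comparisons is a comparison for the composite homomorphism. -/
theorem IsInduced.comp {φ : A →ₐ[k] B} {ψ : B →ₐ[k] C} {G : aSpec k B ⟶ aSpec k A}
    {H : aSpec k C ⟶ aSpec k B} (hG : IsInduced φ G) (hH : IsInduced ψ H) :
    IsInduced (ψ.comp φ) (H ≫ G) := by
  obtain ⟨hb, τ, hτ, hc⟩ := hG
  obtain ⟨hb', τ', hτ', hc'⟩ := hH
  refine ⟨fun P => ?_, τ ≫ (TopCat.Presheaf.pushforward RingCat.{u + 1} G.hom.base).map τ',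
    fun U s n P hB hA => ?_, ?_⟩
  · exact (hb _).trans ((congrArg (contraction φ) (hb' P)).trans (contraction_comp φ ψ P).symm)
  · have hA1 : ∀ i, contraction φ (contraction ψ (P i)) ∈ ptSet U := fun i =>
      contraction_comp φ ψ (P i) ▸ hA i
    -- The intermediate family lies over `U` because `G` acts on points as the contraction along
    -- `φ`.
    have hB1 : ∀ i, contraction ψ (P i) ∈
        ptSet ((TopologicalSpace.Opens.map G.hom.base).obj U) := fun i => by
      have := hA1 i
      rw [← hb] at this
      exact this
    obtain ⟨g, hg, e⟩ := hτ U s n (contraction ψ ∘ P) hB1 hA1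
    obtain ⟨g', hg', e'⟩ := hτ' ((TopologicalSpace.Opens.map G.hom.base).obj U)
      ((τ.app (Opposite.op U)).hom s) n P hB hB1
    have key := e'.trans (congrArg g' e)
    have hcmp : IsComparison (ψ.comp φ) id (g'.comp g) := hg.comp hg'
    -- The composite comparison starts at the family contracted in two steps; it is transported to
    -- the family contracted along `ψ.comp φ`, with the membership proof quantified in the motive
    -- because it depends on the family.
    refine Eq.rec (motive := fun Q _ => ∀ h : ∀ i, Q i ∈ ptSet U,
      ∃ g : localRingAt Q →+* localRingAt P, IsComparison (ψ.comp φ) id g ∧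
        _ = g (s.1 ⟨n, Q, h⟩)) (fun _ => ⟨g'.comp g, hcmp, key⟩)
      (funext fun i => (contraction_comp φ ψ (P i)).symm) hA
  · exact pushforward_comp_square G.hom.base H.hom.base hc hc'

/-- Turns any equation with `aSpecMap` into the claim that a morphism is induced, which is how both
functoriality laws are obtained. -/
theorem isInduced_iff {φ : A →ₐ[k] B} {G : aSpec k B ⟶ aSpec k A} :
    IsInduced φ G ↔ G = aSpecMap φ :=
  ⟨fun h => h.unique (isInduced_aSpecMap φ), fun h => h ▸ isInduced_aSpecMap φ⟩

end Functoriality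

end AssocScheme

theorem mainTheorem1 (k : Type u) [Field k] :
    -- the universal property of the rings of local functions
    (∀ (A B : Type u) [Ring A] [Ring B] [Algebra k A] [Algebra k B] (φ : A →ₐ[k] B) (n : ℕ)
        (P : Fin n → AssocScheme.Pt k B),
      ∃! g : AssocScheme.localRingAt (AssocScheme.contraction φ ∘ P) →+* AssocScheme.localRingAt P,
        AssocScheme.IsComparison φ id g) ∧
    -- the natural morphisms of ringed spaces
    ∃ Φ : ∀ (A B : Type u) [Ring A] [Ring B] [Algebra k A] [Algebra k B],
        (A →ₐ[k] B) → (AssocScheme.aSpec k B ⟶ AssocScheme.aSpec k A),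
      (∀ (A B : Type u) [Ring A] [Ring B] [Algebra k A] [Algebra k B] (φ : A →ₐ[k] B)
          (G : AssocScheme.aSpec k B ⟶ AssocScheme.aSpec k A),
        AssocScheme.IsInduced φ G ↔ G = Φ A B φ) ∧
      (∀ (A : Type u) [Ring A] [Algebra k A], Φ A A (AlgHom.id k A) = 𝟙 (AssocScheme.aSpec k A)) ∧
      (∀ (A B C : Type u) [Ring A] [Ring B] [Ring C] [Algebra k A] [Algebra k B] [Algebra k C]
          (φ : A →ₐ[k] B) (ψ : B →ₐ[k] C), Φ A C (ψ.comp φ) = Φ B C ψ ≫ Φ A B φ) := by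
  exact ⟨fun A B _ _ _ _ φ n P => AssocScheme.existsUnique_isComparison φ P,
    fun A B _ _ _ _ φ => AssocScheme.aSpecMap φ,
    fun A B _ _ _ _ φ G => AssocScheme.isInduced_iff,
    fun A _ _ => (AssocScheme.isInduced_iff.1 (AssocScheme.isInduced_id A)).symm,
    fun A B C _ _ _ _ _ _ φ ψ => (AssocScheme.isInduced_iff.1
      ((AssocScheme.isInduced_aSpecMap φ).comp (AssocScheme.isInduced_aSpecMap ψ))).symm⟩
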